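/- Let $n,m\ge 1$ and $p\ge0$ be integers and let $f_{i,j}:\mathbb R^p\to\mathbb R$ ($1\le i\le n$, $1\le j\le m$) be differentiable, $f_i:=\frac1m\sum_{j=1}^m f_{i,j}$, $F:=\frac1n\sum_{i=1}^n f_i$. Assume that $F^*:=\inf_{\mathbf x}F(\mathbf x)>-\infty$ and that for some $L>0$ $$\tfrac1m\sum_{j=1}^m\|\nabla f_{i,j}(\mathbf x)-\nabla f_{i,j}(\mathbf y)\|^2\le L^2\|\mathbf x-\mathbf y\|^2\qquad\text{for all } i \text{ and all } \mathbf x,\mathbf y\in\mathbb R^p.$$ Let $W=(w_{ir})\in\mathbb R^{n\times n}$ be nonnegative, doubly stochastic and primitive, with positive diagonal entries, and let $\lambda:=\|W-\frac1n\mathbf 1\mathbf 1^\top\|$ (spectral norm). Let $q\ge1$ and $1\le B\le m$ be integers, $\alpha>0$, $\overline{\mathbf x}^{0}\in\mathbb R^p$, and let $\tau_{i,l}^{t,s}$ ($1\le t\le q$, $s\ge1$, $1\le i\le n$, $1\le l\le B$) be independent random variables, each uniformly distributed on $\{1,\dots,m\}$. GT-SARAH starts from $\mathbf x_i^{0,1}=\overline{\mathbf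 x}^{0}$, $\mathbf y_i^{0,1}=\mathbf 0$, $\mathbf v_i^{-1,1}=\mathbf 0$ and computes, for $s=1,2,\dots$ (outer loops), $t=0,1,\dots,q$ (inner steps) and $1\le i\le n$, $$\mathbf v_i^{0,s}=\nabla f_i(\mathbf x_i^{0,s}),\qquad \mathbf v_i^{t,s}=\tfrac1B\sum_{l=1}^B\Big(\nabla f_{i,\tau_{i,l}^{t,s}}(\mathbf x_i^{t,s})-\nabla f_{i,\tau_{i,l}^{t,s}}(\mathbf x_i^{t-1,s})\Big)+\mathbf v_i^{t-1,s}\quad(t\ge1),$$ $$\mathbf y_i^{t+1,s}=\sum_{r=1}^n w_{ir}\mathbf y_r^{t,s}+\mathbf v_i^{t,s}-\mathbf v_i^{t-1,s},\qquad \mathbf x_i^{t+1,s}=\sum_{r=1}^n w_{ir}\mathbf x_r^{t,s}-\alpha\,\mathbf y_i^{t+1,s},$$ followed by $\mathbf x_i^{0,s+1}=\mathbf x_i^{q+1,s}$, $\mathbf y_i^{0,s+1}=\mathbf y_i^{q+1,s}$, $\mathbf v_i^{-1,s+1}=\mathbf v_i^{q,s}$. Write $\overline{\mathbf x}^{t,s}:=\frac1n\sum_i\mathbf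 x_i^{t,s}$. Suppose that $$0<\alpha\le\min\bigg\{\frac{(1-\lambda^2)^2}{4\sqrt{42}},\ \Big(\frac{nB}{6q}\Big)^{1/2},\ \Big(\frac{4nB}{7nB+24q}\Big)^{1/3}\frac{1-\lambda^2}{6}\bigg\}\frac1{2L}.$$ Then for every $\epsilon>0$ and every integer $S\ge1$ with $$S\ \ge\ \frac{1}{(q+1)\alpha L\epsilon^2}\bigg(4L\big(F(\overline{\mathbf x}^{0})-F^*\big)+\frac1n\sum_{i=1}^n\|\nabla f_i(\overline{\mathbf x}^{0})\|^2\bigg),$$ GT-SARAH finds an $\epsilon$-accurate first-order stationary point of $F$ in $S$ outer loops, that is, all the expectations below are finite and $$\frac{1}{S(q+1)}\sum_{s=1}^{S}\sum_{t=0}^{q}\frac1n\sum_{i=1}^n\mathbb E\Big[\|\nabla F(\mathbf x_i^{t,s})\|^2+L^2\|\mathbf x_i^{t,s}-\overline{\mathbf x}^{t,s}\|^2\Big]\le\epsilon^2.$$ In particular, the number of outer loops required is at most the right-hand side of the condition on $S$, rounded up to a positive integer. -/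

import Mathlib

open MeasureTheory ProbabilityTheory
open scoped ENNReal

noncomputable section

namespace GTSarah

/-- The Euclidean space `ℝ^p`. -/
abbrev Vec (p : ℕ) : Type := EuclideanSpace ℝ (Fin p)

variable {n m p : ℕ}

/-- Local cost of node `i`: the average of its `m` component costs. -/
def localCost (f : Fin n → Fin m → Vec p → ℝ) (i : Fin n) (x : Vec p) : ℝ :=
  (1 / (m : ℝ)) * ∑ j, f i j x

/-- Global cost: the average of the `n` local costs. -/
def globalCost (f : Fin n → Fin m → Vec p → ℝ) (x : Vec p) : ℝ :=
  (1 / (n : ℝ)) * ∑ i, localCost f i x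

/-- Every component cost is differentiable and, at every node, the components are mean-squared
smooth with parameter `L`. -/
def IsMeanSquaredSmooth (f : Fin n → Fin m → Vec p → ℝ) (L : ℝ) : Prop :=
  (∀ i j, Differentiable ℝ (f i j)) ∧
    ∀ i x y, (1 / (m : ℝ)) * ∑ j, ‖gradient (f i j) x - gradient (f i j) y‖ ^ 2
      ≤ L ^ 2 * ‖x - y‖ ^ 2

/-- A weight matrix: doubly stochastic (in particular entrywise nonnegative), primitive, with
positive diagonal entries. -/
def IsWeightMatrix (W : Matrix (Fin n) (Fin n) ℝ) : Prop :=
  W ∈ doublyStochastic ℝ (Fin n) ∧ W.IsPrimitive ∧ ∀ i, 0 < W i i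

/-- The number `λ`: the spectral norm (operator norm for the Euclidean norm) of `W - (1/n) 1 1ᵀ`. -/
def mixingRate (W : Matrix (Fin n) (Fin n) ℝ) : ℝ :=
  ‖Matrix.toEuclideanCLM (n := Fin n) (𝕜 := ℝ) (W - Matrix.of fun _ _ => 1 / (n : ℝ))‖

/-- Network average of the vectors held by the nodes. -/
def average (x : Fin n → Vec p) : Vec p := (1 / (n : ℝ)) • ∑ i, x i

/-- The data carried along by the algorithm on reaching inner step `t` of an outer loop:
`x = x^t`, `xPrev = x^(t-1)`, `y = y^t`, `vPrev = v^(t-1)`, each with one vector per node.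
(`xPrev` is not used when `t = 0`.) -/
structure State (n p : ℕ) where
  x : Fin n → Vec p
  xPrev : Fin n → Vec p
  y : Fin n → Vec p
  vPrev : Fin n → Vec p

/-- Initial data: all nodes at the common point `x₀`, with `y = 0` and `v = 0`. -/
def initState (n : ℕ) (x₀ : Vec p) : State n p where
  x := fun _ => x₀
  xPrev := fun _ => x₀
  y := fun _ => 0
  vPrev := fun _ => 0

/-- The local gradient estimators `v^t`: the full local gradients if `t = 0`, and the recursive
minibatch estimators if `t ≥ 1`; `c i l` is the `l`-th component index sampled by node `i`. -/
def estimator (f : Fin n → Fin m → Vec p → ℝ) {B : ℕ} (c : Fin n → Fin B → Fin m)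
    (t : ℕ) (st : State n p) (i : Fin n) : Vec p :=
  if t = 0 then gradient (localCost f i) (st.x i)
  else (1 / (B : ℝ)) • ∑ l, (gradient (f i (c i l)) (st.x i)
      - gradient (f i (c i l)) (st.xPrev i)) + st.vPrev i

/-- The gradient trackers `y^(t+1)`. -/
def tracker (f : Fin n → Fin m → Vec p → ℝ) (W : Matrix (Fin n) (Fin n) ℝ)
    {B : ℕ} (c : Fin n → Fin B → Fin m) (t : ℕ) (st : State n p) (i : Fin n) : Vec p :=
  ∑ r, W i r • st.y r + estimator f c t st i - st.vPrev i

/-- Inner step `t`: gradient estimation, gradient tracking, state update. -/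
def step (f : Fin n → Fin m → Vec p → ℝ) (W : Matrix (Fin n) (Fin n) ℝ) (α : ℝ)
    {B : ℕ} (c : Fin n → Fin B → Fin m) (t : ℕ) (st : State n p) : State n p where
  x := fun i => ∑ r, W i r • st.x r - α • tracker f W c t st i
  xPrev := st.x
  y := tracker f W c t st
  vPrev := estimator f c t st

/-- The data after performing the steps `0, …, t - 1` of one outer loop; `c t i l` is the
`l`-th component index sampled by node `i` at inner step `t`. -/
def innerLoop (f : Fin n → Fin m → Vec p → ℝ) (W : Matrix (Fin n) (Fin n) ℝ) (α : ℝ)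
    {B : ℕ} (c : ℕ → Fin n → Fin B → Fin m) (st : State n p) : ℕ → State n p
  | 0 => st
  | t + 1 => step f W α (c t) t (innerLoop f W α c st t)

/-- The data at the start of outer loop number `s`. Outer loops are numbered `0, 1, 2, …`;
each performs the steps `0, …, q`, and the next one starts from its final data. -/
def outerLoop (f : Fin n → Fin m → Vec p → ℝ) (W : Matrix (Fin n) (Fin n) ℝ) (α : ℝ) (q : ℕ)
    {B : ℕ} (c : ℕ → ℕ → Fin n → Fin B → Fin m) (x₀ : Vec p) : ℕ → State n p
  | 0 => initState n x₀
  | s + 1 => innerLoop f W α (c s) (outerLoop f W α q c x₀ s) (q + 1)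

/-- The GT-SARAH iterate of node `i` at inner step `t` of outer loop `s` (outer loops numbered
from `0`), when the sampled component indices are `c s t i l`. -/
def iterate (f : Fin n → Fin m → Vec p → ℝ) (W : Matrix (Fin n) (Fin n) ℝ) (α : ℝ) (q : ℕ)
    {B : ℕ} (c : ℕ → ℕ → Fin n → Fin B → Fin m) (x₀ : Vec p) (s t : ℕ) (i : Fin n) : Vec p :=
  (innerLoop f W α (c s) (outerLoop f W α q c x₀ s) t).x i

/-- The sampled indices `τ s t i l` (outer loop `s`, inner step `1 ≤ t ≤ q`, node `i`, position
`1 ≤ l ≤ B` in the minibatch) form an independent family of uniformly distributed random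
variables. Nothing is assumed about `τ s t` for other values of `t`; the iterates do not
depend on them. -/
structure IsUniformSampling {Ω : Type*} [MeasurableSpace Ω] (μ : Measure Ω) (q : ℕ) {B : ℕ}
    (τ : ℕ → ℕ → Fin n → Fin B → Ω → Fin m) : Prop where
  measurable : ∀ s, ∀ t ∈ Set.Icc 1 q, ∀ i l, Measurable (τ s t i l)
  uniform : ∀ s, ∀ t ∈ Set.Icc 1 q, ∀ i l j, μ (τ s t i l ⁻¹' {j}) = (m : ℝ≥0∞)⁻¹
  indep : iIndepFun
    (fun k : ℕ × Set.Icc 1 q × Fin n × Fin B => τ k.1 k.2.1 k.2.2.1 k.2.2.2) μ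

/-- Squared gradient norm plus weighted squared consensus error at node `i`. -/
def stationarityGap (f : Fin n → Fin m → Vec p → ℝ) (L : ℝ) (x : Fin n → Vec p) (i : Fin n) : ℝ :=
  ‖gradient (globalCost f) (x i)‖ ^ 2 + L ^ 2 * ‖x i - average x‖ ^ 2

/-- The random iterates `X s t i` reach an `ε`-accurate first-order stationary point of the global
cost in `S` outer loops: the expected gap, averaged over the nodes, the inner steps `0, …, q` and
the first `S` outer loops, is (well defined and) at most `ε ^ 2`. -/
def FindsStationaryPoint {Ω : Type*} [MeasurableSpace Ω] (μ : Measure Ω)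
    (f : Fin n → Fin m → Vec p → ℝ) (L : ℝ) (q : ℕ) (X : ℕ → ℕ → Fin n → Ω → Vec p)
    (ε : ℝ) (S : ℕ) : Prop :=
  (∀ s < S, ∀ t ≤ q, ∀ i, Integrable (fun ω => stationarityGap f L (fun r => X s t r ω) i) μ) ∧
    (1 / ((S : ℝ) * (q + 1))) * ∑ s ∈ Finset.range S, ∑ t ∈ Finset.range (q + 1),
      (1 / (n : ℝ)) * ∑ i, ∫ ω, stationarityGap f L (fun r => X s t r ω) i ∂μ ≤ ε ^ 2

/-- The upper bound on the step-size. -/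
def stepSizeBound (n B q : ℕ) (L lam : ℝ) : ℝ :=
  min (min ((1 - lam ^ 2) ^ 2 / (4 * Real.sqrt 42)) (Real.sqrt ((n * B : ℝ) / (6 * q))))
    (((4 * n * B : ℝ) / (7 * n * B + 24 * q)) ^ (1 / 3 : ℝ) * ((1 - lam ^ 2) / 6))
    * (1 / (2 * L))

/-- The bound on the number of outer loops. -/
def outerLoopBound (f : Fin n → Fin m → Vec p → ℝ) (L α ε : ℝ) (q : ℕ) (x₀ : Vec p) : ℝ :=
  (1 / (((q : ℝ) + 1) * α * L * ε ^ 2)) *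
    (4 * L * (globalCost f x₀ - ⨅ x, globalCost f x)
      + (1 / (n : ℝ)) * ∑ i, ‖gradient (localCost f i) x₀‖ ^ 2)

end GTSarah

end

/-! The argument has two layers: inequalities valid along every sample path, and second-moment
bounds on the finite space of sample paths with uniform weights, where expectations are finite
averages `𝔼`.

Pathwise, gradient tracking keeps the network mean of the trackers equal to that of the estimators
(`average_y_eq_average_vPrev`), so the mean iterate moves by `-α` times the mean estimator.
Smoothness then makes the global cost decrease, up to the consensus error and the error of the mean
estimator (`globalCost_step_le`). Mixing contracts the consensus and tracking errors by the factor
`(1 + λ²) / 2`; the first is driven by the tracking error, the second by the estimator increments.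

Stochastically, the estimator error vanishes at the start of each outer loop and then grows by
centered minibatch terms. These are orthogonal given the past, so their variances add
(`expect_norm_sq_add_sum`), and mean-squared smoothness bounds each by the displacement of the
iterates. Averaging over independently sampling nodes gains a factor `1 / n`.

The displacements are in turn controlled by the mean estimator and the consensus error, which closes
the loop. `sum_loops_le` sums all recursions over the outer loops, and `combine_estimates` solves
the resulting linear system: a small step-size lets the negative multiple of the squared mean
estimator in the descent inequality absorb what is left. Finally `integral_comp_eq_expect`
identifies the integrals over `Ω` with the finite averages. -/

open scoped BigOperators

noncomputable section

namespace GTSarah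

variable {n m p : ℕ}

/-! ### Averages, deviations and mean squares over a finite index set -/

section Averages

/-- Mean of the squared norms of the vectors held by the nodes. -/
def meanSq (x : Fin n → Vec p) : ℝ := (1 / (n : ℝ)) * ∑ i, ‖x i‖ ^ 2

lemma meanSq_nonneg (x : Fin n → Vec p) : 0 ≤ meanSq x := by
  unfold meanSq; positivity

lemma norm_sq_mean_le {E : Type*} [NormedAddCommGroup E] [NormedSpace ℝ E] {k : ℕ}
    (v : Fin k → E) :
    ‖(1 / (k : ℝ)) • ∑ i, v i‖ ^ 2 ≤ (1 / (k : ℝ)) * ∑ i, ‖v i‖ ^ 2 := by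
  rcases Nat.eq_zero_or_pos k with rfl | hk
  · simp
  have hk' : (0 : ℝ) < k := by exact_mod_cast hk
  have h1 : ‖∑ i, v i‖ ^ 2 ≤ k * ∑ i, ‖v i‖ ^ 2 := by
    calc ‖∑ i, v i‖ ^ 2 ≤ (∑ i, ‖v i‖) ^ 2 := by
          gcongr; exact norm_sum_le _ _
      _ ≤ _ := by simpa using sq_sum_le_card_mul_sum_sq (s := Finset.univ) (f := fun i => ‖v i‖)
  rw [norm_smul, mul_pow, Real.norm_of_nonneg (by positivity)]
  calc (1 / (k : ℝ)) ^ 2 * ‖∑ i, v i‖ ^ 2 ≤ (1 / (k : ℝ)) ^ 2 * (k * ∑ i, ‖v i‖ ^ 2) := by gcongr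
    _ = _ := by field_simp

lemma norm_sq_average_le (x : Fin n → Vec p) : ‖average x‖ ^ 2 ≤ meanSq x :=
  norm_sq_mean_le x

lemma average_add (x y : Fin n → Vec p) : average (x + y) = average x + average y := by
  simp [average, Finset.sum_add_distrib]

lemma average_sub (x y : Fin n → Vec p) : average (x - y) = average x - average y := by
  simp [average, Finset.sum_sub_distrib, smul_sub]

lemma average_smul (a : ℝ) (x : Fin n → Vec p) : average (a • x) = a • average x := by
  simp [average, ← Finset.smul_sum, smul_comm a]

lemma average_const (hn : 1 ≤ n) (v : Vec p) : average (fun _ : Fin n => v) = v := by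
  have : (n : ℝ) ≠ 0 := by positivity
  simp only [average, Finset.sum_const, Finset.card_univ, Fintype.card_fin]
  rw [← Nat.cast_smul_eq_nsmul ℝ, smul_smul]
  simp [this]

/-- Deviations of the vectors held by the nodes from their network average. -/
def deviation (x : Fin n → Vec p) : Fin n → Vec p := fun i => x i - average x

lemma deviation_const (hn : 1 ≤ n) (v : Vec p) : deviation (fun _ : Fin n => v) = 0 := by
  funext i; simp [deviation, average_const hn]

lemma deviation_add (x y : Fin n → Vec p) : deviation (x + y) = deviation x + deviation y := by
  funext i; simp only [deviation, average_add, Pi.add_apply]; abel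

lemma meanSq_deviation_le (x : Fin n → Vec p) : meanSq (deviation x) ≤ meanSq x := by
  rcases Nat.eq_zero_or_pos n with rfl | hn
  · simp [meanSq]
  have hn' : (0 : ℝ) < n := by exact_mod_cast hn
  have hs : ∑ i, x i = (n : ℝ) • average x := by
    rw [average, smul_smul]; simp [hn'.ne']
  have : ∑ i, ‖deviation x i‖ ^ 2 = ∑ i, ‖x i‖ ^ 2 - n * ‖average x‖ ^ 2 := by
    simp only [deviation, norm_sub_sq_real]
    rw [Finset.sum_add_distrib, Finset.sum_sub_distrib, ← Finset.mul_sum, ← sum_inner, hs,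
      real_inner_smul_left, real_inner_self_eq_norm_sq]
    simp
    ring
  unfold meanSq
  rw [this]
  gcongr
  have : 0 ≤ (n : ℝ) * ‖average x‖ ^ 2 := by positivity
  linarith

lemma meanSq_smul (a : ℝ) (x : Fin n → Vec p) : meanSq (a • x) = a ^ 2 * meanSq x := by
  simp only [meanSq, Pi.smul_apply, norm_smul, mul_pow, Real.norm_eq_abs, sq_abs]
  rw [← Finset.mul_sum]; ring

lemma norm_add_sq_le_two {E : Type*} [SeminormedAddCommGroup E] (a b : E) :
    ‖a + b‖ ^ 2 ≤ 2 * ‖a‖ ^ 2 + 2 * ‖b‖ ^ 2 := by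
  nlinarith [norm_add_le a b, norm_nonneg (a + b), sq_nonneg (‖a‖ - ‖b‖)]

lemma norm_add_sq_le_young {E : Type*} [SeminormedAddCommGroup E] (a b : E) {η : ℝ} (hη : 0 < η) :
    ‖a + b‖ ^ 2 ≤ (1 + η) * ‖a‖ ^ 2 + (1 + η⁻¹) * ‖b‖ ^ 2 := by
  have h1 : 0 ≤ η⁻¹ * (η * ‖a‖ - ‖b‖) ^ 2 := by positivity
  have h2 : η⁻¹ * (η * ‖a‖ - ‖b‖) ^ 2 = η * ‖a‖ ^ 2 - 2 * (‖a‖ * ‖b‖) + η⁻¹ * ‖b‖ ^ 2 := by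
    field_simp
    ring
  nlinarith [norm_add_le a b, norm_nonneg (a + b)]

lemma meanSq_add_le_two (x y : Fin n → Vec p) : meanSq (x + y) ≤ 2 * meanSq x + 2 * meanSq y := by
  have : ∑ i, ‖(x + y) i‖ ^ 2 ≤ 2 * ∑ i, ‖x i‖ ^ 2 + 2 * ∑ i, ‖y i‖ ^ 2 := by
    rw [Finset.mul_sum, Finset.mul_sum, ← Finset.sum_add_distrib]
    exact Finset.sum_le_sum fun i _ => norm_add_sq_le_two _ _
  unfold meanSq
  calc _ ≤ (1 / (n : ℝ)) * (2 * ∑ i, ‖x i‖ ^ 2 + 2 * ∑ i, ‖y i‖ ^ 2) := by gcongr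
    _ = _ := by ring

lemma meanSq_add_le_young (x y : Fin n → Vec p) {η : ℝ} (hη : 0 < η) :
    meanSq (x + y) ≤ (1 + η) * meanSq x + (1 + η⁻¹) * meanSq y := by
  have : ∑ i, ‖(x + y) i‖ ^ 2 ≤ (1 + η) * ∑ i, ‖x i‖ ^ 2 + (1 + η⁻¹) * ∑ i, ‖y i‖ ^ 2 := by
    rw [Finset.mul_sum, Finset.mul_sum, ← Finset.sum_add_distrib]
    exact Finset.sum_le_sum fun i _ => norm_add_sq_le_young _ _ hη
  unfold meanSq
  calc _ ≤ (1 / (n : ℝ)) * ((1 + η) * ∑ i, ‖x i‖ ^ 2 + (1 + η⁻¹) * ∑ i, ‖y i‖ ^ 2) := by gcongr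
    _ = _ := by ring

end Averages

/-! ### Contraction of deviations under the weight matrix -/

section Mixing

/-- One round of weighted averaging over the network. -/
def mix (W : Matrix (Fin n) (Fin n) ℝ) (x : Fin n → Vec p) : Fin n → Vec p :=
  fun i => ∑ r, W i r • x r

lemma average_mix {W : Matrix (Fin n) (Fin n) ℝ} (hW : W ∈ doublyStochastic ℝ (Fin n))
    (x : Fin n → Vec p) : average (mix W x) = average x := by
  unfold average mix
  rw [Finset.sum_comm]
  congr 1
  refine Finset.sum_congr rfl fun r _ => ?_
  rw [← Finset.sum_smul, sum_col_of_mem_doublyStochastic hW, one_smul]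

/-- The matrix `(1/n) 1 1ᵀ` annihilates a centered vector, so on such vectors `W` acts as the matrix
whose operator norm is `mixingRate W`. -/
lemma sum_sq_centered_mulVec_le (W : Matrix (Fin n) (Fin n) ℝ) (u : Fin n → ℝ)
    (hu : ∑ i, u i = 0) :
    ∑ i, (∑ r, W i r * u r) ^ 2 ≤ mixingRate W ^ 2 * ∑ i, u i ^ 2 := by
  have h := (Matrix.toEuclideanCLM (n := Fin n) (𝕜 := ℝ)
    (W - Matrix.of fun _ _ => 1 / (n : ℝ))).le_opNorm (WithLp.toLp 2 u)
  have h2 := pow_le_pow_left₀ (norm_nonneg _) h 2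
  rw [mul_pow, EuclideanSpace.norm_sq_eq, EuclideanSpace.norm_sq_eq] at h2
  have e : ∀ i, ((Matrix.toEuclideanCLM (n := Fin n) (𝕜 := ℝ)
      (W - Matrix.of fun _ _ => 1 / (n : ℝ))) (WithLp.toLp 2 u)).ofLp i = ∑ r, W i r * u r := by
    intro i
    rw [Matrix.ofLp_toEuclideanCLM]
    simp only [Matrix.mulVec, dotProduct, Matrix.sub_apply, Matrix.of_apply, sub_mul]
    rw [Finset.sum_sub_distrib, ← Finset.mul_sum, hu]
    simp
  simp only [e, Real.norm_eq_abs, sq_abs] at h2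
  exact h2

/-- Double stochasticity makes mixing commute with taking deviations; the scalar bound then applies
to each of the `p` coordinates of the centered family. -/
lemma meanSq_deviation_mix_le {W : Matrix (Fin n) (Fin n) ℝ}
    (hW : W ∈ doublyStochastic ℝ (Fin n)) (x : Fin n → Vec p) :
    meanSq (deviation (mix W x)) ≤ mixingRate W ^ 2 * meanSq (deviation x) := by
  rcases Nat.eq_zero_or_pos n with rfl | hn
  · simp [meanSq]
  have hn' : (n : ℝ) ≠ 0 := by positivity
  have hdev : ∀ i, deviation (mix W x) i = ∑ r, W i r • deviation x r := by
    intro i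
    simp only [deviation, smul_sub, Finset.sum_sub_distrib, ← Finset.sum_smul,
      sum_row_of_mem_doublyStochastic hW, one_smul, average_mix hW]
    rfl
  have hzero : ∑ i, deviation x i = 0 := by
    simp only [deviation, Finset.sum_sub_distrib, Finset.sum_const, Finset.card_univ,
      Fintype.card_fin]
    rw [← Nat.cast_smul_eq_nsmul ℝ, average, smul_smul]
    simp [hn']
  have key : ∑ i, ‖deviation (mix W x) i‖ ^ 2
      ≤ mixingRate W ^ 2 * ∑ i, ‖deviation x i‖ ^ 2 := by
    simp only [EuclideanSpace.norm_sq_eq, Real.norm_eq_abs, sq_abs]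
    rw [Finset.sum_comm, Finset.sum_comm (f := fun i k => (deviation x i).ofLp k ^ 2),
      Finset.mul_sum]
    refine Finset.sum_le_sum fun k _ => ?_
    have := sum_sq_centered_mulVec_le W (fun i => deviation x i k) (by
      have := congrArg (fun v : Vec p => v k) hzero
      simpa using this)
    simpa [hdev] using this
  unfold meanSq
  calc _ ≤ (1 / (n : ℝ)) * (mixingRate W ^ 2 * ∑ i, ‖deviation x i‖ ^ 2) := by gcongr
    _ = _ := by ring

lemma meanSq_deviation_mix_add_le {W : Matrix (Fin n) (Fin n) ℝ}
    (hW : W ∈ doublyStochastic ℝ (Fin n)) (hlam : mixingRate W ^ 2 < 1) (x d : Fin n → Vec p) :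
    meanSq (deviation (mix W x + d)) ≤ (1 + mixingRate W ^ 2) / 2 * meanSq (deviation x)
      + 2 / (1 - mixingRate W ^ 2) * meanSq (deviation d) := by
  set l := mixingRate W ^ 2 with hl
  have hl0 : 0 ≤ l := sq_nonneg _
  have h1 : 0 < 1 - l := by linarith
  -- This Young parameter turns the factor `l` into `2 * l / (1 + l)`, which is at most `(1 + l) /
  -- 2` because `4 * l ≤ (1 + l) ^ 2`.
  have hη : 0 < (1 - l) / (1 + l) := by positivity
  rw [deviation_add]
  refine (meanSq_add_le_young _ _ hη).trans ?_
  have e1 : 1 + (1 - l) / (1 + l) = 2 / (1 + l) := by field_simp; ring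
  have e2 : 1 + ((1 - l) / (1 + l))⁻¹ = 2 / (1 - l) := by field_simp; ring
  rw [e1, e2]
  gcongr ?_ + _
  calc 2 / (1 + l) * meanSq (deviation (mix W x))
      ≤ 2 / (1 + l) * (l * meanSq (deviation x)) := by
        gcongr; exact meanSq_deviation_mix_le hW x
    _ = (2 / (1 + l) * l) * meanSq (deviation x) := by ring
    _ ≤ _ := by
        gcongr
        · exact meanSq_nonneg _
        · rw [div_mul_eq_mul_div, div_le_div_iff₀ (by positivity) (by positivity)]
          nlinarith [sq_nonneg (1 - l)]

end Mixing

/-! ### Gradients of the averaged costs and the quadratic upper bound -/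

section Smoothness

lemma hasGradientAt_const_mul_sum {k : ℕ} {g : Fin k → Vec p → ℝ} {g' : Fin k → Vec p} {x : Vec p}
    (h : ∀ j, HasGradientAt (g j) (g' j) x) (a : ℝ) :
    HasGradientAt (fun x => a * ∑ j, g j x) (a • ∑ j, g' j) x := by
  rw [hasGradientAt_iff_hasFDerivAt]
  have := (HasFDerivAt.fun_sum (u := Finset.univ) fun j _ => (h j).hasFDerivAt).const_mul a
  exact this.congr_fderiv (by rw [map_smul, map_sum])

variable {f : Fin n → Fin m → Vec p → ℝ} {L : ℝ}

lemma hasGradientAt_localCost (hf : ∀ i j, Differentiable ℝ (f i j)) (i : Fin n) (x : Vec p) :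
    HasGradientAt (localCost f i) ((1 / (m : ℝ)) • ∑ j, gradient (f i j) x) x :=
  hasGradientAt_const_mul_sum (fun j => (hf i j x).hasGradientAt) _

lemma gradient_localCost (hf : ∀ i j, Differentiable ℝ (f i j)) (i : Fin n) (x : Vec p) :
    gradient (localCost f i) x = (1 / (m : ℝ)) • ∑ j, gradient (f i j) x :=
  (hasGradientAt_localCost hf i x).gradient

lemma hasGradientAt_globalCost (hf : ∀ i j, Differentiable ℝ (f i j)) (x : Vec p) :
    HasGradientAt (globalCost f) (average fun i => gradient (localCost f i) x) x :=
  hasGradientAt_const_mul_sum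
    (fun i => (hasGradientAt_localCost hf i x).differentiableAt.hasGradientAt) _

lemma gradient_globalCost (hf : ∀ i j, Differentiable ℝ (f i j)) (x : Vec p) :
    gradient (globalCost f) x = average fun i => gradient (localCost f i) x :=
  (hasGradientAt_globalCost hf x).gradient

lemma norm_sq_gradient_localCost_sub_le (hf : IsMeanSquaredSmooth f L) (i : Fin n) (x y : Vec p) :
    ‖gradient (localCost f i) x - gradient (localCost f i) y‖ ^ 2 ≤ L ^ 2 * ‖x - y‖ ^ 2 := by
  rw [gradient_localCost hf.1, gradient_localCost hf.1, ← smul_sub, ← Finset.sum_sub_distrib]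
  exact (norm_sq_mean_le _).trans (hf.2 i x y)

lemma meanSq_gradient_localCost_sub_le (hf : IsMeanSquaredSmooth f L) (x y : Fin n → Vec p) :
    meanSq (fun i => gradient (localCost f i) (x i) - gradient (localCost f i) (y i))
      ≤ L ^ 2 * meanSq (x - y) := by
  unfold meanSq
  calc _ ≤ (1 / (n : ℝ)) * ∑ i, L ^ 2 * ‖(x - y) i‖ ^ 2 := by
        gcongr with i
        exact norm_sq_gradient_localCost_sub_le hf i _ _
    _ = _ := by rw [← Finset.mul_sum]; ring

lemma norm_sq_average_gradient_sub_le (hf : IsMeanSquaredSmooth f L) (x y : Fin n → Vec p) :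
    ‖average (fun i => gradient (localCost f i) (x i))
      - average (fun i => gradient (localCost f i) (y i))‖ ^ 2 ≤ L ^ 2 * meanSq (x - y) := by
  rw [← average_sub]
  exact (norm_sq_average_le _).trans (meanSq_gradient_localCost_sub_le hf x y)

lemma norm_gradient_globalCost_sub_le (hn : 1 ≤ n) (hL : 0 ≤ L) (hf : IsMeanSquaredSmooth f L)
    (x y : Vec p) :
    ‖gradient (globalCost f) x - gradient (globalCost f) y‖ ≤ L * ‖x - y‖ := by
  have hn' : (n : ℝ) ≠ 0 := by positivity
  rw [gradient_globalCost hf.1, gradient_globalCost hf.1,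
    ← sq_le_sq₀ (norm_nonneg _) (by positivity), mul_pow]
  refine (norm_sq_average_gradient_sub_le hf (fun _ => x) (fun _ => y)).trans (le_of_eq ?_)
  simp [meanSq, hn']

/-- The quadratic upper bound for a function with Lipschitz gradient. -/
lemma le_add_inner_add_sq {F : Vec p → ℝ} (hF : Differentiable ℝ F)
    (hLip : ∀ x y, ‖gradient F x - gradient F y‖ ≤ L * ‖x - y‖) (x d : Vec p) :
    F (x + d) ≤ F x + inner ℝ (gradient F x) d + L / 2 * ‖d‖ ^ 2 := by
  -- Along the segment, `φ` is `F` minus the first and second order terms of the bound. The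
  -- Lipschitz condition makes its derivative nonpositive on the open unit interval, and `φ 1 ≤ φ 0`
  -- is the claim.
  set φ : ℝ → ℝ := fun t => F (x + t • d) - t * inner ℝ (gradient F x) d - L / 2 * t ^ 2 * ‖d‖ ^ 2
    with hφ
  have hder : ∀ t, HasDerivAt φ
      (inner ℝ (gradient F (x + t • d)) d - inner ℝ (gradient F x) d - L * t * ‖d‖ ^ 2) t := by
    intro t
    have h1 : HasDerivAt (fun t : ℝ => x + t • d) d t := by
      simpa using ((hasDerivAt_id t).smul_const d).const_add x
    have h2 : HasDerivAt (fun t : ℝ => F (x + t • d)) (inner ℝ (gradient F (x + t • d)) d) t := by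
      have := (hF (x + t • d)).hasFDerivAt.comp_hasDerivAt t h1
      rw [inner_gradient_left]
      exact this
    have h3 := (hasDerivAt_id t).mul_const (inner ℝ (gradient F x) d)
    have h4 := (((hasDerivAt_id t).pow 2).const_mul (L / 2)).mul_const (‖d‖ ^ 2)
    refine ((h2.sub h3).sub h4).congr_deriv ?_
    simp only [id, Nat.cast_ofNat]
    ring
  have hanti : AntitoneOn φ (Set.Icc 0 1) := by
    refine antitoneOn_of_deriv_nonpos (convex_Icc 0 1)
      (fun t _ => (hder t).continuousAt.continuousWithinAt)
      (fun t _ => (hder t).differentiableAt.differentiableWithinAt) fun t ht => ?_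
    rw [interior_Icc] at ht
    rw [(hder t).deriv, ← inner_sub_left]
    have h1 := real_inner_le_norm (gradient F (x + t • d) - gradient F x) d
    have h2 := hLip (x + t • d) x
    rw [add_sub_cancel_left, norm_smul, Real.norm_of_nonneg ht.1.le] at h2
    nlinarith [norm_nonneg d, mul_le_mul_of_nonneg_right h2 (norm_nonneg d)]
  have := hanti (Set.left_mem_Icc.2 zero_le_one) (Set.right_mem_Icc.2 zero_le_one) zero_le_one
  simp only [hφ, one_smul, zero_smul, add_zero] at this
  linarith

end Smoothness

/-! ### Pathwise inequalities for one inner step -/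

section Step

variable {f : Fin n → Fin m → Vec p → ℝ} {W : Matrix (Fin n) (Fin n) ℝ} {α L : ℝ} {B : ℕ}
  {c : Fin n → Fin B → Fin m} {t : ℕ} {st : State n p}

lemma step_y_eq :
    (step f W α c t st).y = mix W st.y + (estimator f c t st - st.vPrev) := by
  funext i
  simp only [step, tracker, mix, Pi.add_apply, Pi.sub_apply]
  abel

lemma step_x_eq : (step f W α c t st).x = mix W st.x + (-α) • (step f W α c t st).y := by
  funext i
  simp [step, mix, sub_eq_add_neg]

lemma average_step_y (hW : W ∈ doublyStochastic ℝ (Fin n))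
    (hst : average st.y = average st.vPrev) :
    average (step f W α c t st).y = average (estimator f c t st) := by
  rw [step_y_eq, average_add, average_mix hW, average_sub, hst]
  abel

lemma average_step_x (hW : W ∈ doublyStochastic ℝ (Fin n))
    (hst : average st.y = average st.vPrev) :
    average (step f W α c t st).x = average st.x - α • average (estimator f c t st) := by
  rw [step_x_eq, average_add, average_mix hW, average_smul, average_step_y hW hst, neg_smul,
    sub_eq_add_neg]

lemma meanSq_deviation_step_x_le (hW : W ∈ doublyStochastic ℝ (Fin n))
    (hlam : mixingRate W ^ 2 < 1) :
    meanSq (deviation (step f W α c t st).x)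
      ≤ (1 + mixingRate W ^ 2) / 2 * meanSq (deviation st.x)
        + 2 * α ^ 2 / (1 - mixingRate W ^ 2) * meanSq (deviation (step f W α c t st).y) := by
  have h := meanSq_deviation_mix_add_le hW hlam st.x ((-α) • (step f W α c t st).y)
  have e : deviation ((-α) • (step f W α c t st).y) = (-α) • deviation (step f W α c t st).y := by
    funext i
    simp only [deviation, average_smul, Pi.smul_apply, smul_sub]
  rw [e, meanSq_smul, ← step_x_eq] at h
  refine h.trans (le_of_eq ?_)
  ring

lemma meanSq_deviation_step_y_le (hW : W ∈ doublyStochastic ℝ (Fin n))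
    (hlam : mixingRate W ^ 2 < 1) :
    meanSq (deviation (step f W α c t st).y)
      ≤ (1 + mixingRate W ^ 2) / 2 * meanSq (deviation st.y)
        + 2 / (1 - mixingRate W ^ 2) * meanSq (estimator f c t st - st.vPrev) := by
  rw [step_y_eq]
  refine (meanSq_deviation_mix_add_le hW hlam _ _).trans ?_
  have : 0 < 1 - mixingRate W ^ 2 := by linarith
  gcongr
  exact meanSq_deviation_le _

/-- The displacement of a node is its new deviation, minus its old one, plus the displacement `-α
v̄` of the mean iterate; the factor 3 comes from squaring three terms. -/
lemma meanSq_step_x_sub_le (hW : W ∈ doublyStochastic ℝ (Fin n))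
    (hst : average st.y = average st.vPrev) (hn : 1 ≤ n) :
    meanSq ((step f W α c t st).x - st.x)
      ≤ 3 * α ^ 2 * ‖average (estimator f c t st)‖ ^ 2 + 3 * meanSq (deviation st.x)
        + 3 * meanSq (deviation (step f W α c t st).x) := by
  have hn' : (n : ℝ) ≠ 0 := by positivity
  have hav := average_step_x (f := f) (α := α) (c := c) (t := t) hW hst
  set v := average (estimator f c t st)
  set x' := (step f W α c t st).x
  have key : ∀ i, ‖(x' - st.x) i‖ ^ 2
      ≤ 3 * α ^ 2 * ‖v‖ ^ 2 + 3 * ‖deviation st.x i‖ ^ 2 + 3 * ‖deviation x' i‖ ^ 2 := by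
    intro i
    have e : (x' - st.x) i = deviation x' i + (-(α • v)) + (-(deviation st.x i)) := by
      simp only [deviation, hav, Pi.sub_apply]; abel
    have h1 : ‖(x' - st.x) i‖ ≤ ‖deviation x' i‖ + |α| * ‖v‖ + ‖deviation st.x i‖ := by
      rw [e]
      refine (norm_add₃_le).trans ?_
      rw [norm_neg, norm_neg, norm_smul, Real.norm_eq_abs]
    calc ‖(x' - st.x) i‖ ^ 2 ≤ (‖deviation x' i‖ + |α| * ‖v‖ + ‖deviation st.x i‖) ^ 2 := by gcongr
      _ ≤ 3 * (|α| * ‖v‖) ^ 2 + 3 * ‖deviation st.x i‖ ^ 2 + 3 * ‖deviation x' i‖ ^ 2 := by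
        nlinarith [sq_nonneg (‖deviation x' i‖ - |α| * ‖v‖),
          sq_nonneg (‖deviation x' i‖ - ‖deviation st.x i‖),
          sq_nonneg (|α| * ‖v‖ - ‖deviation st.x i‖)]
      _ = _ := by rw [mul_pow, sq_abs]; ring
  unfold meanSq
  calc _ ≤ (1 / (n : ℝ)) * ∑ i, (3 * α ^ 2 * ‖v‖ ^ 2 + 3 * ‖deviation st.x i‖ ^ 2
        + 3 * ‖deviation x' i‖ ^ 2) := by gcongr with i; exact key i
    _ = _ := by
      simp only [Finset.sum_add_distrib, ← Finset.mul_sum]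
      simp
      field_simp

/-- Apply the quadratic upper bound to the step `-α v̄` and polarize the inner product of `g` and
`v̄` through `‖v̄ - g‖ ^ 2`. That square is split at the mean `w` of the local gradients at the
nodes: one part is the estimator error, the other is consensus error. -/
lemma globalCost_step_le (hn : 1 ≤ n) (hL : 0 ≤ L) (hα : 0 ≤ α) (hf : IsMeanSquaredSmooth f L)
    (hW : W ∈ doublyStochastic ℝ (Fin n)) (hst : average st.y = average st.vPrev) :
    globalCost f (average (step f W α c t st).x) ≤ globalCost f (average st.x)
      - α / 2 * ‖gradient (globalCost f) (average st.x)‖ ^ 2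
      - α / 2 * (1 - L * α) * ‖average (estimator f c t st)‖ ^ 2
      + α * ‖average (estimator f c t st)
          - average (fun i => gradient (localCost f i) (st.x i))‖ ^ 2
      + α * L ^ 2 * meanSq (deviation st.x) := by
  set v := average (estimator f c t st)
  set g := gradient (globalCost f) (average st.x) with hg
  set w := average (fun i => gradient (localCost f i) (st.x i))
  have h1 := le_add_inner_add_sq (F := globalCost f) (L := L)
    (fun x => (hasGradientAt_globalCost hf.1 x).differentiableAt)
    (norm_gradient_globalCost_sub_le hn hL hf) (average st.x) (-(α • v))
  rw [← sub_eq_add_neg, ← average_step_x (f := f) (α := α) (c := c) (t := t) hW hst, norm_neg,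
    norm_smul, mul_pow, Real.norm_eq_abs, sq_abs, inner_neg_right, real_inner_smul_right,
    ← hg] at h1
  have h2 : ‖v - g‖ ^ 2 = ‖v‖ ^ 2 - 2 * inner ℝ g v + ‖g‖ ^ 2 := by
    rw [norm_sub_sq_real, real_inner_comm]
  have h3 : ‖v - g‖ ^ 2 ≤ 2 * ‖v - w‖ ^ 2 + 2 * ‖w - g‖ ^ 2 := by
    simpa using norm_add_sq_le_two (v - w) (w - g)
  have h4 : ‖w - g‖ ^ 2 ≤ L ^ 2 * meanSq (deviation st.x) := by
    rw [hg, gradient_globalCost hf.1]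
    exact norm_sq_average_gradient_sub_le hf st.x (fun _ => average st.x)
  have h5 : α / 2 * ‖v - g‖ ^ 2 ≤ α / 2 * (2 * ‖v - w‖ ^ 2 + 2 * (L ^ 2 * meanSq (deviation st.x))) := by
    gcongr
    linarith
  rw [h2] at h5
  linarith

lemma mean_stationarityGap_le (hn : 1 ≤ n) (hL : 0 ≤ L) (hf : IsMeanSquaredSmooth f L)
    (x : Fin n → Vec p) :
    (1 / (n : ℝ)) * ∑ i, stationarityGap f L x i
      ≤ 2 * ‖gradient (globalCost f) (average x)‖ ^ 2 + 3 * L ^ 2 * meanSq (deviation x) := by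
  have hn' : (n : ℝ) ≠ 0 := by positivity
  have key : ∀ i, stationarityGap f L x i
      ≤ 2 * ‖gradient (globalCost f) (average x)‖ ^ 2 + 3 * L ^ 2 * ‖deviation x i‖ ^ 2 := by
    intro i
    have h1 := norm_add_sq_le_two
      (gradient (globalCost f) (x i) - gradient (globalCost f) (average x))
      (gradient (globalCost f) (average x))
    rw [sub_add_cancel] at h1
    have h2 := pow_le_pow_left₀ (norm_nonneg _)
      (norm_gradient_globalCost_sub_le hn hL hf (x i) (average x)) 2
    rw [mul_pow] at h2
    simp only [stationarityGap, deviation]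
    linarith
  unfold meanSq
  calc _ ≤ (1 / (n : ℝ)) * ∑ i, (2 * ‖gradient (globalCost f) (average x)‖ ^ 2
        + 3 * L ^ 2 * ‖deviation x i‖ ^ 2) := by gcongr with i; exact key i
    _ = _ := by
      simp only [Finset.sum_add_distrib, ← Finset.mul_sum]
      simp
      field_simp

end Step

/-! ### Summation over nested loops and the final linear system -/

section Recursions

/-- The end of one outer loop is the start of the next, so the double sum telescopes across the
loops as well as inside them. -/
lemma sum_loops_succ_sub (q : ℕ) (a : ℕ → ℕ → ℝ) (h : ∀ s, a (s + 1) 0 = a s (q + 1)) (S : ℕ) :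
    ∑ s ∈ Finset.range S, ∑ t ∈ Finset.range (q + 1), (a s (t + 1) - a s t)
      = a S 0 - a 0 0 := by
  simp only [Finset.sum_range_sub, ← h]
  exact Finset.sum_range_sub (fun s => a s 0) S

lemma sum_loops_le_sum_loops_succ (q : ℕ) (a : ℕ → ℕ → ℝ) (h : ∀ s, a (s + 1) 0 = a s (q + 1))
    (S : ℕ) (h0 : a 0 0 = 0) (hS : 0 ≤ a S 0) :
    ∑ s ∈ Finset.range S, ∑ t ∈ Finset.range (q + 1), a s t
      ≤ ∑ s ∈ Finset.range S, ∑ t ∈ Finset.range (q + 1), a s (t + 1) := by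
  have := sum_loops_succ_sub q a h S
  simp only [Finset.sum_sub_distrib] at this
  linarith

lemma sum_loops_contraction {q : ℕ} {a b : ℕ → ℕ → ℝ} {ρ : ℝ} (hρ : 0 ≤ ρ)
    (h : ∀ s, a (s + 1) 0 = a s (q + 1)) {S : ℕ} (h0 : a 0 0 = 0) (hS : 0 ≤ a S 0)
    (hab : ∀ s < S, ∀ t ≤ q, a s (t + 1) ≤ ρ * a s t + b s t) :
    (1 - ρ) * ∑ s ∈ Finset.range S, ∑ t ∈ Finset.range (q + 1), a s (t + 1)
      ≤ ∑ s ∈ Finset.range S, ∑ t ∈ Finset.range (q + 1), b s t := by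
  have h1 := sum_loops_le_sum_loops_succ q a h S h0 hS
  have h2 : ∑ s ∈ Finset.range S, ∑ t ∈ Finset.range (q + 1), a s (t + 1)
      ≤ ρ * ∑ s ∈ Finset.range S, ∑ t ∈ Finset.range (q + 1), a s t
        + ∑ s ∈ Finset.range S, ∑ t ∈ Finset.range (q + 1), b s t := by
    simp only [Finset.mul_sum, ← Finset.sum_add_distrib]
    refine Finset.sum_le_sum fun s hs => Finset.sum_le_sum fun t ht => hab s ?_ t ?_
    · simpa using hs
    · simpa [Nat.lt_succ_iff] using ht
  nlinarith [mul_le_mul_of_nonneg_left h1 hρ]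

lemma le_sum_of_increments {q : ℕ} {a b : ℕ → ℝ} (h0 : a 0 ≤ 0)
    (h : ∀ t < q, a (t + 1) ≤ a t + b t) (t : ℕ) (ht : t ≤ q) :
    a t ≤ ∑ u ∈ Finset.range t, b u := by
  induction t with
  | zero => simpa using h0
  | succ t ih =>
    rw [Finset.sum_range_succ]
    linarith [h t (by omega), ih (by omega)]

lemma sum_le_mul_sum_of_increments {q : ℕ} {a b : ℕ → ℝ} (h0 : a 0 ≤ 0) (hb : ∀ t, 0 ≤ b t)
    (h : ∀ t < q, a (t + 1) ≤ a t + b t) :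
    ∑ t ∈ Finset.range (q + 1), a t ≤ q * ∑ t ∈ Finset.range (q + 1), b t := by
  -- The term at `t = 0` is nonpositive; isolating it yields the factor `q` instead of `q + 1`, as
  -- the step-size conditions require.
  rw [Finset.sum_range_succ']
  calc _ ≤ ∑ t ∈ Finset.range q, ∑ u ∈ Finset.range (q + 1), b u + 0 := by
        refine add_le_add (Finset.sum_le_sum fun t ht => ?_) h0
        rw [Finset.mem_range] at ht
        refine (le_sum_of_increments h0 h (t + 1) (by omega)).trans ?_
        exact Finset.sum_le_sum_of_subset_of_nonneg
          (Finset.range_subset_range.2 (by omega)) fun i _ _ => hb i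
    _ = _ := by simp

/-- The estimates for the consensus error `c`, the tracking error `y` and the gradient estimation
error `e`, combined under the step-size conditions; here `u = α L`, `a = 1 - λ²` and
`κ = q / (n B)`. -/
lemma combine_estimates {G V c₀ c y x e Δ Z u a κ : ℝ} (hu : 0 < u) (ha : 0 < a) (ha1 : a ≤ 1)
    (hκ : 0 ≤ κ) (hV : 0 ≤ V) (hZ : 0 ≤ Z) (hc : 0 ≤ c)
    (hu1 : 2688 * u ^ 2 ≤ a ^ 4) (hu2 : 24 * κ * u ^ 2 ≤ 1)
    (hu3 : 1728 * u ^ 3 * (7 + 24 * κ) ≤ 4 * a ^ 3)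
    (h1 : c₀ ≤ c) (h2 : a ^ 2 * c ≤ 4 * u ^ 2 * y) (h3 : a ^ 2 * y ≤ 2 * a * Z + 12 * x)
    (h4 : x ≤ 3 * u ^ 2 * V + 6 * c) (h5 : e ≤ κ * x)
    (h6 : G + (1 - u) * V ≤ 2 * Δ + 2 * e + 2 * c₀) :
    2 * G + 3 * c₀ ≤ 4 * Δ + Z / u := by
  -- Square root of `hu1`, since `50 ^ 2 = 2500 ≤ 2688`.
  have hu50 : 50 * u ≤ a ^ 2 := by
    have : (50 * u) ^ 2 ≤ (a ^ 2) ^ 2 := by nlinarith [sq_nonneg u]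
    exact (sq_le_sq₀ (by positivity) (by positivity)).1 this
  have ha2 : a ^ 2 ≤ 1 := pow_le_one₀ ha.le ha1
  -- Chaining consensus, tracking and displacement bounds `c` by itself; `hu1` gives `288 * u ^ 2 ≤
  -- (3 / 28) * a ^ 4`, so absorbing that term leaves the fraction 25/28 of the left side.
  have hxc : a ^ 4 * c ≤ 8 * u ^ 2 * a * Z + 144 * u ^ 4 * V + 288 * u ^ 2 * c := by
    have e1 := mul_le_mul_of_nonneg_left h2 (sq_nonneg a)
    have e2 := mul_le_mul_of_nonneg_left h3 (show 0 ≤ 4 * u ^ 2 by positivity)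
    have e3 := mul_le_mul_of_nonneg_left h4 (show 0 ≤ 48 * u ^ 2 by positivity)
    linear_combination e1 + e2 + e3
  have hc' : 25 * (a ^ 4 * c) ≤ 28 * (8 * u ^ 2 * a * Z + 144 * u ^ 4 * V) := by
    have := mul_le_mul_of_nonneg_right hu1 hc
    linarith
  have hk : 0 ≤ 7 + 24 * κ := by positivity
  -- The coefficient is what the final count needs: 3 from the goal, 4 from twice the descent
  -- inequality, and `24 * κ` from the estimator error `4 * e`.
  have key : (7 + 24 * κ) * c ≤ Z / u + V / 2 := by
    have e1 : 25 * (a ^ 4 * (u * ((7 + 24 * κ) * c)))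
        ≤ 28 * (a ^ 4 * (Z / 54 + u * V / 150)) := by
      have f1 := mul_le_mul_of_nonneg_left hc' (mul_nonneg hu.le hk)
      have f2 := mul_le_mul_of_nonneg_left hu3 (show 0 ≤ 28 * 8 / 1728 * a * Z by positivity)
      have f3 := mul_le_mul_of_nonneg_left hu3
        (show 0 ≤ 28 * 144 / 1728 * u ^ 2 * V by positivity)
      have f4 := mul_le_mul_of_nonneg_left hu50
        (show 0 ≤ 28 / 150 * a ^ 3 * u * V by positivity)
      have f5 := mul_le_mul_of_nonneg_left ha1
        (show 0 ≤ 28 / 150 * a ^ 4 * u * V by positivity)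
      linear_combination f1 + f2 + f3 + f4 + f5
    have e2 : 25 * (u * ((7 + 24 * κ) * c)) ≤ 28 * (Z / 54 + u * V / 150) := by
      have : a ^ 4 * (25 * (u * ((7 + 24 * κ) * c))) ≤ a ^ 4 * (28 * (Z / 54 + u * V / 150)) := by
        linarith
      exact le_of_mul_le_mul_left this (by positivity)
    have e3 : u * ((7 + 24 * κ) * c) ≤ u * (Z / u + V / 2) := by
      have : u * (Z / u + V / 2) = Z + u * V / 2 := by field_simp
      rw [this]
      have : 0 ≤ u * V := by positivity
      linarith
    exact le_of_mul_le_mul_left e3 hu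
  have he : 4 * e ≤ V / 2 + 24 * κ * c := by
    have e1 := mul_le_mul_of_nonneg_left h4 hκ
    have e2 := mul_le_mul_of_nonneg_right hu2 hV
    linarith
  have huV : u * V ≤ V / 2 := by
    have : u ≤ 1 / 2 := by linarith
    nlinarith
  -- Doubling `h6` provides `-2 * V`, spent exactly: `V / 2` in `key`, `V / 2` in `he`, and `V` on
  -- `2 * u * V`.
  linarith

end Recursions

/-! ### Conditioning and orthogonality on a finite uniform product space -/

section UniformExpectation

variable {K J E : Type*} [Fintype K] [DecidableEq K] [Fintype J] [Nonempty J]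

/-- Resampling one coordinate of a uniformly distributed family does not change expectations. -/
lemma expect_expect_update (H : (K → J) → ℝ) (k : K) :
    𝔼 z, 𝔼 j, H (Function.update z k j) = 𝔼 z, H z := by
  classical
  -- Exchanging coordinate `k` with the fresh value is an involution, hence preserves the uniform
  -- weights.
  let e : (K → J) × J ≃ (K → J) × J :=
    { toFun := fun a => (Function.update a.1 k a.2, a.1 k)
      invFun := fun a => (Function.update a.1 k a.2, a.1 k)
      left_inv := fun a => by simp
      right_inv := fun a => by simp }
  calc 𝔼 z, 𝔼 j, H (Function.update z k j)
      = 𝔼 a : (K → J) × J, H (Function.update a.1 k a.2) := by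
        rw [← Finset.univ_product_univ,
          Finset.expect_product _ _ (fun a : (K → J) × J => H (Function.update a.1 k a.2))]
    _ = 𝔼 a : (K → J) × J, H a.1 := Fintype.expect_equiv e _ _ fun a => rfl
    _ = 𝔼 z, 𝔼 _j : J, H z := by
        rw [← Finset.univ_product_univ, Finset.expect_product _ _ (fun a : (K → J) × J => H a.1)]
    _ = 𝔼 z, H z := by simp

/-- The function `A` does not depend on coordinate `k` of its argument. -/
def IndepOfCoord {E : Type*} (A : (K → J) → E) (k : K) : Prop :=
  ∀ z j, A (Function.update z k j) = A z

variable [NormedAddCommGroup E] [InnerProductSpace ℝ E]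

/-- Resampling coordinate `k` plays the role of conditioning on the others: `A` is then constant
while `ξ` has mean zero. -/
lemma expect_inner_eq_zero {A ξ : (K → J) → E} {k : K} (hA : IndepOfCoord A k)
    (hξ : ∀ z, ∑ j, ξ (Function.update z k j) = 0) : 𝔼 z, inner ℝ (A z) (ξ z) = 0 := by
  rw [← expect_expect_update _ k]
  refine Finset.expect_eq_zero fun z _ => ?_
  rw [Fintype.expect_eq_sum_div_card]
  simp only [hA z, ← inner_sum, hξ, inner_zero_right, zero_div]

/-- Additivity of the second moment along increments with conditional mean zero. -/
lemma expect_norm_sq_add_sum {P : Type*} (κ : P → K) {A : (K → J) → E} {ξ : P → (K → J) → E}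
    (s : Finset P) (hA : ∀ a ∈ s, IndepOfCoord A (κ a))
    (hξ : ∀ a ∈ s, ∀ b ∈ s, a ≠ b → IndepOfCoord (ξ a) (κ b))
    (hmean : ∀ a ∈ s, ∀ z, ∑ j, ξ a (Function.update z (κ a) j) = 0) :
    𝔼 z, ‖A z + ∑ a ∈ s, ξ a z‖ ^ 2 = 𝔼 z, ‖A z‖ ^ 2 + ∑ a ∈ s, 𝔼 z, ‖ξ a z‖ ^ 2 := by
  classical
  induction s using Finset.induction_on with
  | empty => simp
  | insert b s hb ih =>
    have ih' := ih (fun a ha => hA a (Finset.mem_insert_of_mem ha))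
      (fun a ha c hc => hξ a (Finset.mem_insert_of_mem ha) c (Finset.mem_insert_of_mem hc))
      (fun a ha => hmean a (Finset.mem_insert_of_mem ha))
    have hcross : 𝔼 z, inner ℝ (A z + ∑ a ∈ s, ξ a z) (ξ b z) = 0 := by
      refine expect_inner_eq_zero (k := κ b) (fun z j => ?_) (hmean b (Finset.mem_insert_self b s))
      rw [hA b (Finset.mem_insert_self b s) z j]
      congr 1
      refine Finset.sum_congr rfl fun a ha => ?_
      exact hξ a (Finset.mem_insert_of_mem ha) b (Finset.mem_insert_self b s)
        (fun h => hb (h ▸ ha)) z j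
    have hexp : ∀ z, ‖A z + ∑ a ∈ insert b s, ξ a z‖ ^ 2
        = ‖A z + ∑ a ∈ s, ξ a z‖ ^ 2 + 2 * inner ℝ (A z + ∑ a ∈ s, ξ a z) (ξ b z)
          + ‖ξ b z‖ ^ 2 := by
      intro z
      rw [Finset.sum_insert hb, add_comm (ξ b z), ← add_assoc, norm_add_sq_real]
    simp only [hexp, Finset.expect_add_distrib, ← Finset.mul_expect]
    rw [hcross, ih', Finset.sum_insert hb]
    ring

lemma expect_eq_mean [NeZero m] (g : Fin m → ℝ) : 𝔼 j, g j = (1 / (m : ℝ)) * ∑ j, g j := by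
  rw [Fintype.expect_eq_sum_div_card, Fintype.card_fin, div_eq_inv_mul, one_div]

/-- The family `h z` is determined by the other coordinates, so evaluating it at the uniform index
`z k` averages over its `m` members. -/
lemma expect_norm_sq_sample [NeZero m] {k : K} {h : (K → Fin m) → Fin m → Vec p}
    (hh : IndepOfCoord h k) : 𝔼 z, ‖h z (z k)‖ ^ 2 = 𝔼 z, meanSq (h z) := by
  rw [← expect_expect_update _ k]
  refine Finset.expect_congr rfl fun z _ => ?_
  simp only [hh z, Function.update_self, expect_eq_mean]
  rfl

end UniformExpectation

/-! ### Second moments of minibatches of gradient differences; means here run over the `m`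
components -/

section Minibatch

variable {K : Type*} [DecidableEq K] {f : Fin n → Fin m → Vec p → ℝ} {L : ℝ}
  {B : ℕ} {x x' : (K → Fin m) → Fin n → Vec p} {κ : Fin n → Fin B → K}

/-- Differences of the component gradients of node `i` between two points. -/
def gradDiff (f : Fin n → Fin m → Vec p → ℝ) (i : Fin n) (u v : Vec p) : Fin m → Vec p :=
  fun j => gradient (f i j) u - gradient (f i j) v

lemma average_gradDiff (hf : ∀ i j, Differentiable ℝ (f i j)) (i : Fin n) (u v : Vec p) :
    average (gradDiff f i u v) = gradient (localCost f i) u - gradient (localCost f i) v := by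
  rw [gradient_localCost hf, gradient_localCost hf]
  exact average_sub (fun j => gradient (f i j) u) (fun j => gradient (f i j) v)

lemma meanSq_gradDiff_le (hf : IsMeanSquaredSmooth f L) (i : Fin n) (u v : Vec p) :
    meanSq (gradDiff f i u v) ≤ L ^ 2 * ‖u - v‖ ^ 2 :=
  hf.2 i u v

lemma IndepOfCoord.gradDiff (i : Fin n) {k : K} (hx : IndepOfCoord x k) (hx' : IndepOfCoord x' k) :
    IndepOfCoord (fun z => gradDiff f i (x' z i) (x z i)) k := fun z j => by
  simp only [hx z j, hx' z j]

variable [Fintype K] [NeZero m]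

lemma expect_norm_sq_gradDiff_le (hf : IsMeanSquaredSmooth f L) (i : Fin n) {k : K}
    (hx : IndepOfCoord x k) (hx' : IndepOfCoord x' k) :
    𝔼 z, ‖gradDiff f i (x' z i) (x z i) (z k)‖ ^ 2 ≤ L ^ 2 * 𝔼 z, ‖x' z i - x z i‖ ^ 2 := by
  rw [expect_norm_sq_sample (h := fun z => GTSarah.gradDiff f i (x' z i) (x z i))
    (IndepOfCoord.gradDiff i hx hx'), Finset.mul_expect]
  exact Finset.expect_le_expect fun z _ => meanSq_gradDiff_le hf i _ _

lemma expect_norm_sq_deviation_gradDiff_le (hf : IsMeanSquaredSmooth f L) (i : Fin n) {k : K}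
    (hx : IndepOfCoord x k) (hx' : IndepOfCoord x' k) :
    𝔼 z, ‖deviation (gradDiff f i (x' z i) (x z i)) (z k)‖ ^ 2
      ≤ L ^ 2 * 𝔼 z, ‖x' z i - x z i‖ ^ 2 := by
  rw [expect_norm_sq_sample (h := fun z => deviation (GTSarah.gradDiff f i (x' z i) (x z i)))
    (fun z j => congrArg deviation (IndepOfCoord.gradDiff i hx hx' z j)), Finset.mul_expect]
  exact Finset.expect_le_expect fun z _ =>
    (meanSq_deviation_le _).trans (meanSq_gradDiff_le hf i _ _)

lemma sum_deviation (g : Fin m → Vec p) : ∑ j, deviation g j = 0 := by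
  have hm : (m : ℝ) ≠ 0 := by exact_mod_cast NeZero.ne m
  simp only [deviation, Finset.sum_sub_distrib, Finset.sum_const, Finset.card_univ,
    Fintype.card_fin]
  rw [← Nat.cast_smul_eq_nsmul ℝ, average, smul_smul]
  simp [hm]

/-- Second moment of an error after adding a centered minibatch of gradient differences. -/
lemma expect_norm_sq_add_minibatch_le (hf : IsMeanSquaredSmooth f L)
    (hκ : Function.Injective2 κ)
    (hx : ∀ i l, IndepOfCoord x (κ i l)) (hx' : ∀ i l, IndepOfCoord x' (κ i l))
    {A : (K → Fin m) → Vec p} (hA : ∀ i l, IndepOfCoord A (κ i l)) (w : ℝ)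
    (I : Finset (Fin n)) :
    𝔼 z, ‖A z + ∑ i ∈ I, ∑ l, w • deviation (gradDiff f i (x' z i) (x z i)) (z (κ i l))‖ ^ 2
      ≤ 𝔼 z, ‖A z‖ ^ 2 + w ^ 2 * B * L ^ 2 * ∑ i ∈ I, 𝔼 z, ‖x' z i - x z i‖ ^ 2 := by
  have h := expect_norm_sq_add_sum (fun a : Fin n × Fin B => κ a.1 a.2) (A := A)
    (ξ := fun a z => w • deviation (gradDiff f a.1 (x' z a.1) (x z a.1)) (z (κ a.1 a.2)))
    (I ×ˢ Finset.univ) (fun a _ => hA _ _) ?_ ?_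
  · simp only [Finset.sum_product] at h
    rw [h]
    gcongr
    rw [Finset.mul_sum]
    refine Finset.sum_le_sum fun i _ => ?_
    calc ∑ l, 𝔼 z, ‖w • deviation (gradDiff f i (x' z i) (x z i)) (z (κ i l))‖ ^ 2
        = ∑ l, w ^ 2 * 𝔼 z, ‖deviation (gradDiff f i (x' z i) (x z i)) (z (κ i l))‖ ^ 2 := by
          simp only [norm_smul, mul_pow, Real.norm_eq_abs, sq_abs, ← Finset.mul_expect]
      _ ≤ ∑ _l : Fin B, w ^ 2 * (L ^ 2 * 𝔼 z, ‖x' z i - x z i‖ ^ 2) := by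
          gcongr with l
          exact expect_norm_sq_deviation_gradDiff_le hf i (hx i l) (hx' i l)
      _ = _ := by simp; ring
  · rintro ⟨i, l⟩ - ⟨i', l'⟩ - hne z j
    have : κ i l ≠ κ i' l' := fun h => hne (by obtain ⟨rfl, rfl⟩ := hκ h; rfl)
    simp only [hx i' l' z j, hx' i' l' z j, Function.update_of_ne this]
  · rintro ⟨i, l⟩ - z
    simp only [hx i l z, hx' i l z, Function.update_self, ← Finset.smul_sum, sum_deviation,
      smul_zero]

end Minibatch

/-! ### Pathwise structure of the trajectory: dependence on samples, tracking, estimator errors -/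

section Trajectory

variable {f : Fin n → Fin m → Vec p → ℝ} {W : Matrix (Fin n) (Fin n) ℝ} {α L : ℝ} {q B : ℕ}
  {x₀ : Vec p}

/-- The data of the algorithm on reaching inner step `t` of outer loop `s`. -/
def loopState (f : Fin n → Fin m → Vec p → ℝ) (W : Matrix (Fin n) (Fin n) ℝ) (α : ℝ) (q : ℕ)
    {B : ℕ} (x₀ : Vec p) (c : ℕ → ℕ → Fin n → Fin B → Fin m) (s t : ℕ) : State n p :=
  innerLoop f W α (c s) (outerLoop f W α q c x₀ s) t

/-- The gradient estimators computed at inner step `t` of outer loop `s`. -/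
def loopEst (f : Fin n → Fin m → Vec p → ℝ) (W : Matrix (Fin n) (Fin n) ℝ) (α : ℝ) (q : ℕ)
    {B : ℕ} (x₀ : Vec p) (c : ℕ → ℕ → Fin n → Fin B → Fin m) (s t : ℕ) : Fin n → Vec p :=
  estimator f (c s t) t (loopState f W α q x₀ c s t)

/-- Errors of the gradient estimators computed at inner step `t` of outer loop `s`. -/
def loopErr (f : Fin n → Fin m → Vec p → ℝ) (W : Matrix (Fin n) (Fin n) ℝ) (α : ℝ) (q : ℕ)
    {B : ℕ} (x₀ : Vec p) (c : ℕ → ℕ → Fin n → Fin B → Fin m) (s t : ℕ) : Fin n → Vec p :=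
  fun i => loopEst f W α q x₀ c s t i
    - gradient (localCost f i) ((loopState f W α q x₀ c s t).x i)

/-- Step 0 uses full local gradients. This matters because nothing is known about the indices given
for `t = 0`. -/
lemma step_zero_congr (c c' : Fin n → Fin B → Fin m) (st : State n p) :
    step f W α c 0 st = step f W α c' 0 st := by
  have h : estimator f c 0 st = estimator f c' 0 st := by funext i; simp [estimator]
  have h' : tracker f W c 0 st = tracker f W c' 0 st := by funext i; simp only [tracker, h]
  simp only [step, h, h']

lemma innerLoop_congr {c c' : ℕ → Fin n → Fin B → Fin m} (st : State n p) {t : ℕ}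
    (h : ∀ t' < t, t' ≠ 0 → c t' = c' t') : innerLoop f W α c st t = innerLoop f W α c' st t := by
  induction t with
  | zero => rfl
  | succ t ih =>
    simp only [innerLoop]
    rw [ih fun t' ht' => h t' (by omega)]
    rcases eq_or_ne t 0 with rfl | ht
    · exact step_zero_congr _ _ _
    · rw [h t (by omega) ht]

lemma outerLoop_congr {c c' : ℕ → ℕ → Fin n → Fin B → Fin m} {s : ℕ}
    (h : ∀ s' < s, ∀ t ∈ Set.Icc 1 q, c s' t = c' s' t) :
    outerLoop f W α q c x₀ s = outerLoop f W α q c' x₀ s := by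
  induction s with
  | zero => rfl
  | succ s ih =>
    simp only [outerLoop]
    rw [ih fun s' hs' => h s' (by omega)]
    exact innerLoop_congr _ fun t ht ht0 => h s (by omega) t ⟨by omega, by omega⟩

/-- Adaptedness: the data on reaching a step are a function of the indices sampled strictly earlier.
It provides both the independence needed for orthogonality and the passage to finitely many samples.
-/
lemma loopState_congr {c c' : ℕ → ℕ → Fin n → Fin B → Fin m} {s t : ℕ} (ht : t ≤ q + 1)
    (h : ∀ s' < s, ∀ t ∈ Set.Icc 1 q, c s' t = c' s' t)
    (h' : ∀ t' ∈ Set.Icc 1 q, t' < t → c s t' = c' s t') :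
    loopState f W α q x₀ c s t = loopState f W α q x₀ c' s t := by
  unfold loopState
  rw [outerLoop_congr h]
  exact innerLoop_congr _ fun t' ht' h0 => h' t' ⟨by omega, by omega⟩ ht'

variable (c : ℕ → ℕ → Fin n → Fin B → Fin m)

lemma loopState_succ (s t : ℕ) : loopState f W α q x₀ c s (t + 1)
    = step f W α (c s t) t (loopState f W α q x₀ c s t) := rfl

lemma loopState_succ_zero (s : ℕ) :
    loopState f W α q x₀ c (s + 1) 0 = loopState f W α q x₀ c s (q + 1) := rfl

/-- Mixing preserves means and each tracker update adds the increment of the estimator, so equality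
persists from the zero initial data, also across outer loops. -/
lemma average_y_eq_average_vPrev (hW : W ∈ doublyStochastic ℝ (Fin n)) (s t : ℕ) :
    average (loopState f W α q x₀ c s t).y = average (loopState f W α q x₀ c s t).vPrev := by
  induction s generalizing t with
  | zero =>
    induction t with
    | zero => rfl
    | succ t ih => exact average_step_y hW ih
  | succ s ihs =>
    induction t with
    | zero => exact ihs (q + 1)
    | succ t ih => exact average_step_y hW ih

lemma loopEst_zero (s : ℕ) (i : Fin n) : loopEst f W α q x₀ c s 0 i
    = gradient (localCost f i) ((loopState f W α q x₀ c s 0).x i) := by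
  simp [loopEst, estimator]

lemma loopErr_zero (s : ℕ) : loopErr f W α q x₀ c s 0 = 0 := by
  funext i
  simp [loopErr, loopEst_zero]

lemma loopEst_succ (s t : ℕ) (i : Fin n) : loopEst f W α q x₀ c s (t + 1) i
    = (1 / (B : ℝ)) • ∑ l, gradDiff f i ((loopState f W α q x₀ c s (t + 1)).x i)
        ((loopState f W α q x₀ c s t).x i) (c s (t + 1) i l) + loopEst f W α q x₀ c s t i := by
  simp only [loopEst, estimator, Nat.add_eq_zero_iff, one_ne_zero, and_false, if_false]
  rfl

/-- The mean of the sampled differences is exactly the change of the local gradient, so the error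
increments are centered: within an outer loop the error is a martingale. -/
lemma loopErr_succ (hB : 1 ≤ B) (hf : ∀ i j, Differentiable ℝ (f i j)) (s t : ℕ) (i : Fin n) :
    loopErr f W α q x₀ c s (t + 1) i = loopErr f W α q x₀ c s t i
      + ∑ l, (1 / (B : ℝ)) • deviation (gradDiff f i ((loopState f W α q x₀ c s (t + 1)).x i)
        ((loopState f W α q x₀ c s t).x i)) (c s (t + 1) i l) := by
  have hB' : (B : ℝ) ≠ 0 := by positivity
  simp only [loopErr, loopEst_succ, deviation, average_gradDiff hf]
  rw [← Finset.smul_sum, Finset.sum_sub_distrib, smul_sub]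
  simp only [Finset.sum_const, Finset.card_univ, Fintype.card_fin]
  rw [← Nat.cast_smul_eq_nsmul ℝ, smul_smul, one_div, inv_mul_cancel₀ hB', one_smul]
  abel

lemma average_loopErr (s t : ℕ) : average (loopErr f W α q x₀ c s t)
    = average (loopEst f W α q x₀ c s t)
      - average fun i => gradient (localCost f i) ((loopState f W α q x₀ c s t).x i) :=
  average_sub _ _

/-- At a restart the estimator jumps from the last recursive estimate to the full gradient; the jump
is the true gradient change minus the last estimator error. -/
lemma meanSq_loopEst_sub_vPrev_le (hf : IsMeanSquaredSmooth f L) (s : ℕ) :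
    meanSq (loopEst f W α q x₀ c (s + 1) 0 - (loopState f W α q x₀ c (s + 1) 0).vPrev)
      ≤ 2 * L ^ 2 * meanSq ((loopState f W α q x₀ c s (q + 1)).x - (loopState f W α q x₀ c s q).x)
        + 2 * meanSq (loopErr f W α q x₀ c s q) := by
  have e : loopEst f W α q x₀ c (s + 1) 0 - (loopState f W α q x₀ c (s + 1) 0).vPrev
      = (fun i => gradient (localCost f i) ((loopState f W α q x₀ c s (q + 1)).x i)
          - gradient (localCost f i) ((loopState f W α q x₀ c s q).x i))
        + (-1 : ℝ) • loopErr f W α q x₀ c s q := by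
    funext i
    simp only [Pi.sub_apply, Pi.add_apply, Pi.smul_apply, loopEst_zero, loopErr,
      loopState_succ_zero]
    change _ - loopEst f W α q x₀ c s q i = _
    simp
  rw [e]
  refine (meanSq_add_le_two _ _).trans ?_
  rw [meanSq_smul]
  have := meanSq_gradient_localCost_sub_le hf (loopState f W α q x₀ c s (q + 1)).x
    (loopState f W α q x₀ c s q).x
  linarith

end Trajectory

/-! ### Sample paths indexed by finitely many positions -/

section SamplePath

/-- Positions of the component indices sampled in the first `S` outer loops. -/
abbrev Position (S q n B : ℕ) : Type := Fin S × Set.Icc 1 q × Fin n × Fin B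

/-- Sample path given by its values at the sampled positions. -/
def samplePath {S q B : ℕ} [NeZero m] (z : Position S q n B → Fin m) :
    ℕ → ℕ → Fin n → Fin B → Fin m :=
  -- The default 0 is immaterial: the data up to step `q + 1` of the first `S` loops do not depend
  -- on it.
  fun s t i l => if h : s < S ∧ t ∈ Set.Icc 1 q then z (⟨s, h.1⟩, ⟨t, h.2⟩, i, l) else 0

variable {f : Fin n → Fin m → Vec p → ℝ} {W : Matrix (Fin n) (Fin n) ℝ} {α L : ℝ} {S q B : ℕ}
  {x₀ : Vec p} [NeZero m]

lemma samplePath_apply (z : Position S q n B → Fin m) {s t : ℕ} (hs : s < S)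
    (ht : t ∈ Set.Icc 1 q) (i : Fin n) (l : Fin B) :
    samplePath z s t i l = z (⟨s, hs⟩, ⟨t, ht⟩, i, l) := by
  simp [samplePath, hs, Set.mem_Icc.1 ht]

lemma samplePath_update (z : Position S q n B → Fin m) (k : Position S q n B) (j : Fin m)
    {s t : ℕ} (h : ¬ (s = k.1 ∧ t = k.2.1)) :
    samplePath (Function.update z k j) s t = samplePath z s t := by
  funext i l
  unfold samplePath
  split_ifs with h'
  · refine Function.update_of_ne (fun hk => h ?_) _ _
    subst hk
    exact ⟨rfl, rfl⟩
  · rfl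

variable {s t : ℕ} (hs : s < S) (ht : t ∈ Set.Icc 1 q) (i : Fin n) (l : Fin B)

lemma indepOfCoord_loopState {t' : ℕ} (ht' : t' ≤ t) :
    IndepOfCoord (fun z : Position S q n B → Fin m => loopState f W α q x₀ (samplePath z) s t')
      (⟨s, hs⟩, ⟨t, ht⟩, i, l) := fun z j => by
  have := ht.2
  refine loopState_congr (by omega) (fun s' hs' u _ => samplePath_update _ _ _ ?_)
    (fun u _ hut => samplePath_update _ _ _ ?_)
  · rintro ⟨h, -⟩
    simp only at h
    omega
  · rintro ⟨-, h⟩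
    simp only at h
    omega

/-- Strict inequality is needed here, since the estimator at step `t` already uses the sample drawn
at step `t`. -/
lemma indepOfCoord_loopEst {t' : ℕ} (ht' : t' < t) :
    IndepOfCoord (fun z : Position S q n B → Fin m => loopEst f W α q x₀ (samplePath z) s t')
      (⟨s, hs⟩, ⟨t, ht⟩, i, l) := fun z j => by
  have h := indepOfCoord_loopState (f := f) (W := W) (α := α) (x₀ := x₀) hs ht i l ht'.le z j
  simp only at h
  simp only [loopEst]
  rw [h, samplePath_update]
  rintro ⟨-, h'⟩
  simp only at h'
  omega

lemma indepOfCoord_loopErr {t' : ℕ} (ht' : t' < t) :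
    IndepOfCoord (fun z : Position S q n B → Fin m => loopErr f W α q x₀ (samplePath z) s t')
      (⟨s, hs⟩, ⟨t, ht⟩, i, l) := fun z j => by
  have h := indepOfCoord_loopState (f := f) (W := W) (α := α) (x₀ := x₀) hs ht i l ht'.le z j
  have h' := indepOfCoord_loopEst (f := f) (W := W) (α := α) (x₀ := x₀) hs ht i l ht' z j
  simp only at h h'
  funext i
  simp only [loopErr, h, h']

end SamplePath

/-! ### Expected recursions for estimator increments and errors -/

section ExpectedRecursions

variable {f : Fin n → Fin m → Vec p → ℝ} {W : Matrix (Fin n) (Fin n) ℝ} {α L : ℝ} {S q B : ℕ}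
  {x₀ : Vec p} {s t : ℕ}

lemma expect_meanSq_sub (a b : (Position S q n B → Fin m) → Fin n → Vec p) :
    𝔼 z, meanSq (a z - b z) = (1 / (n : ℝ)) * ∑ i, 𝔼 z, ‖a z i - b z i‖ ^ 2 := by
  simp only [meanSq, ← Finset.mul_expect, Finset.expect_sum_comm, Pi.sub_apply]

variable [NeZero m]

lemma injective2_position (hs : s < S) (ht : t ∈ Set.Icc 1 q) :
    Function.Injective2 fun (i : Fin n) (l : Fin B) =>
      ((⟨s, hs⟩, ⟨t, ht⟩, i, l) : Position S q n B) := fun i i' l l' h => by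
  simpa using h

/-- The increment is an uncentered minibatch mean, so convexity of the squared norm is used and no
factor `1 / B` appears. -/
lemma expect_meanSq_loopEst_sub_le (hf : IsMeanSquaredSmooth f L) (hB : 1 ≤ B) (hs : s < S)
    (ht : t < q) :
    𝔼 z : Position S q n B → Fin m, meanSq (loopEst f W α q x₀ (samplePath z) s (t + 1)
        - (loopState f W α q x₀ (samplePath z) s (t + 1)).vPrev)
      ≤ L ^ 2 * 𝔼 z : Position S q n B → Fin m,
        meanSq ((loopState f W α q x₀ (samplePath z) s (t + 1)).x
          - (loopState f W α q x₀ (samplePath z) s t).x) := by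
  have ht' : t + 1 ∈ Set.Icc 1 q := ⟨by omega, by omega⟩
  have hB' : (B : ℝ) ≠ 0 := by positivity
  rw [expect_meanSq_sub, expect_meanSq_sub, mul_left_comm, Finset.mul_sum _ _ (L ^ 2)]
  gcongr with i
  have h1 : ∀ z : Position S q n B → Fin m, ‖loopEst f W α q x₀ (samplePath z) s (t + 1) i
        - (loopState f W α q x₀ (samplePath z) s (t + 1)).vPrev i‖ ^ 2
      ≤ (1 / (B : ℝ)) * ∑ l, ‖gradDiff f i ((loopState f W α q x₀ (samplePath z) s (t + 1)).x i)
        ((loopState f W α q x₀ (samplePath z) s t).x i) (z (⟨s, hs⟩, ⟨t + 1, ht'⟩, i, l))‖ ^ 2 := by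
    intro z
    rw [loopEst_succ]
    change ‖_ + loopEst f W α q x₀ (samplePath z) s t i
      - loopEst f W α q x₀ (samplePath z) s t i‖ ^ 2 ≤ _
    rw [add_sub_cancel_right]
    simp only [samplePath_apply z hs ht']
    exact norm_sq_mean_le _
  refine (Finset.expect_le_expect fun z _ => h1 z).trans ?_
  rw [← Finset.mul_expect, Finset.expect_sum_comm]
  refine (mul_le_mul_of_nonneg_left (Finset.sum_le_sum fun l _ =>
    expect_norm_sq_gradDiff_le hf i
      (x := fun z : Position S q n B → Fin m => (loopState f W α q x₀ (samplePath z) s t).x)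
      (x' := fun z => (loopState f W α q x₀ (samplePath z) s (t + 1)).x)
      (fun z j => congrArg State.x
        (indepOfCoord_loopState hs ht' i l (Nat.le_succ t) z j))
      (fun z j => congrArg State.x
        (indepOfCoord_loopState hs ht' i l le_rfl z j))) (by positivity)).trans (le_of_eq ?_)
  simp [hB']

lemma expect_norm_sq_loopErr_add_le (hf : IsMeanSquaredSmooth f L) (hs : s < S) (ht : t < q)
    {A : (Position S q n B → Fin m) → Vec p}
    (hA : ∀ i l, IndepOfCoord A (⟨s, hs⟩, ⟨t + 1, by omega, by omega⟩, i, l)) (w : ℝ)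
    (I : Finset (Fin n)) :
    𝔼 z : Position S q n B → Fin m, ‖A z + ∑ i ∈ I, ∑ l,
        w • deviation (gradDiff f i ((loopState f W α q x₀ (samplePath z) s (t + 1)).x i)
          ((loopState f W α q x₀ (samplePath z) s t).x i)) (samplePath z s (t + 1) i l)‖ ^ 2
      ≤ 𝔼 z, ‖A z‖ ^ 2 + w ^ 2 * B * L ^ 2 * ∑ i ∈ I, 𝔼 z : Position S q n B → Fin m,
        ‖(loopState f W α q x₀ (samplePath z) s (t + 1)).x i
          - (loopState f W α q x₀ (samplePath z) s t).x i‖ ^ 2 := by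
  have ht' : t + 1 ∈ Set.Icc 1 q := ⟨by omega, by omega⟩
  simp only [samplePath_apply _ hs ht']
  exact expect_norm_sq_add_minibatch_le hf (injective2_position hs ht')
    (x := fun z : Position S q n B → Fin m => (loopState f W α q x₀ (samplePath z) s t).x)
    (x' := fun z => (loopState f W α q x₀ (samplePath z) s (t + 1)).x)
    (fun i l z j => congrArg State.x
      (indepOfCoord_loopState hs ht' i l (Nat.le_succ t) z j))
    (fun i l z j => congrArg State.x
      (indepOfCoord_loopState hs ht' i l le_rfl z j)) hA w I

lemma expect_meanSq_loopErr_succ_le (hf : IsMeanSquaredSmooth f L) (hB : 1 ≤ B) (hs : s < S)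
    (ht : t < q) :
    𝔼 z : Position S q n B → Fin m, meanSq (loopErr f W α q x₀ (samplePath z) s (t + 1))
      ≤ 𝔼 z : Position S q n B → Fin m, meanSq (loopErr f W α q x₀ (samplePath z) s t)
        + L ^ 2 / B * 𝔼 z : Position S q n B → Fin m,
          meanSq ((loopState f W α q x₀ (samplePath z) s (t + 1)).x
            - (loopState f W α q x₀ (samplePath z) s t).x) := by
  have ht' : t + 1 ∈ Set.Icc 1 q := ⟨by omega, by omega⟩
  have hB' : (B : ℝ) ≠ 0 := by positivity
  rw [expect_meanSq_sub]
  simp only [meanSq, ← Finset.mul_expect, Finset.expect_sum_comm]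
  rw [mul_left_comm, ← mul_add]
  gcongr
  rw [Finset.mul_sum, ← Finset.sum_add_distrib]
  refine Finset.sum_le_sum fun i _ => ?_
  have h := expect_norm_sq_loopErr_add_le (W := W) (α := α) (x₀ := x₀) hf hs ht
    (A := fun z : Position S q n B → Fin m => loopErr f W α q x₀ (samplePath z) s t i)
    (fun i' l z j => congrFun
      (indepOfCoord_loopErr hs ht' i' l (Nat.lt_succ_self t) z j) i) (1 / (B : ℝ)) {i}
  simp only [Finset.sum_singleton, ← loopErr_succ _ hB hf.1] at h
  refine h.trans (le_of_eq ?_)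
  field_simp

/-- All `n * B` samples of the step contribute orthogonal terms of weight `1 / (n * B)`; this is the
source of the additional `1 / n` compared with the error at single nodes. -/
lemma expect_norm_sq_average_loopErr_succ_le (hf : IsMeanSquaredSmooth f L) (hn : 1 ≤ n)
    (hB : 1 ≤ B) (hs : s < S) (ht : t < q) :
    𝔼 z : Position S q n B → Fin m, ‖average (loopErr f W α q x₀ (samplePath z) s (t + 1))‖ ^ 2
      ≤ 𝔼 z : Position S q n B → Fin m, ‖average (loopErr f W α q x₀ (samplePath z) s t)‖ ^ 2
        + L ^ 2 / (n * B) * 𝔼 z : Position S q n B → Fin m,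
          meanSq ((loopState f W α q x₀ (samplePath z) s (t + 1)).x
            - (loopState f W α q x₀ (samplePath z) s t).x) := by
  have ht' : t + 1 ∈ Set.Icc 1 q := ⟨by omega, by omega⟩
  have hB' : (B : ℝ) ≠ 0 := by positivity
  have hn' : (n : ℝ) ≠ 0 := by positivity
  have h := expect_norm_sq_loopErr_add_le (W := W) (α := α) (x₀ := x₀) hf hs ht
    (A := fun z : Position S q n B → Fin m => average (loopErr f W α q x₀ (samplePath z) s t))
    (fun i' l z j => congrArg average
      (indepOfCoord_loopErr hs ht' i' l (Nat.lt_succ_self t) z j))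
    (1 / (n : ℝ) * (1 / (B : ℝ))) Finset.univ
  have e : ∀ z : Position S q n B → Fin m,
      average (loopErr f W α q x₀ (samplePath z) s (t + 1))
        = average (loopErr f W α q x₀ (samplePath z) s t) + ∑ i, ∑ l,
          (1 / (n : ℝ) * (1 / (B : ℝ))) •
            deviation (gradDiff f i ((loopState f W α q x₀ (samplePath z) s (t + 1)).x i)
              ((loopState f W α q x₀ (samplePath z) s t).x i)) (samplePath z s (t + 1) i l) := by
    intro z
    simp only [average, loopErr_succ _ hB hf.1, Finset.sum_add_distrib, smul_add, mul_smul,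
      Finset.smul_sum]
  simp only [e]
  refine h.trans (le_of_eq ?_)
  rw [expect_meanSq_sub]
  field_simp

end ExpectedRecursions

/-! ### The coupled recursions summed over all loops -/

section CoupledRecursions

/-- The coupled recursions for the consensus error `C`, the tracking error `Y`, the estimator
increments `D`, the displacements `X`, the estimator errors `N`, `M` and the cost `Φ`, summed over
`S` outer loops. Here `a = 1 - λ²`, and `V`, `G` are the squared norms of the mean estimator
and of the gradient at the mean iterate. -/
theorem sum_loops_le {S q : ℕ} {α L a ν b Z Φmin : ℝ} {C Y D X N M V G Φ : ℕ → ℕ → ℝ}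
    (hα : 0 < α) (hL : 0 < L) (ha : 0 < a) (ha1 : a ≤ 1) (hν : 0 < ν) (hb : 1 ≤ b) (hZ : 0 ≤ Z)
    (hu1 : 2688 * (α * L) ^ 2 ≤ a ^ 4) (hu2 : 24 * (q / (ν * b)) * (α * L) ^ 2 ≤ 1)
    (hu3 : 1728 * (α * L) ^ 3 * (7 + 24 * (q / (ν * b))) ≤ 4 * a ^ 3)
    (hC0 : C 0 0 = 0) (hCs : ∀ s, C (s + 1) 0 = C s (q + 1)) (hCnn : ∀ s t, 0 ≤ C s t)
    (hY0 : Y 0 0 = 0) (hYs : ∀ s, Y (s + 1) 0 = Y s (q + 1)) (hYnn : ∀ s t, 0 ≤ Y s t)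
    (hXnn : ∀ s t, 0 ≤ X s t) (hVnn : ∀ s t, 0 ≤ V s t)
    (hΦs : ∀ s, Φ (s + 1) 0 = Φ s (q + 1)) (hΦ : Φmin ≤ Φ S 0)
    (hC : ∀ s t, C s (t + 1) ≤ (1 - a / 2) * C s t + 2 * α ^ 2 / a * Y s (t + 1))
    (hY : ∀ s t, Y s (t + 1) ≤ (1 - a / 2) * Y s t + 2 / a * D s t)
    (hYZ : Y 0 1 ≤ Z)
    (hD0 : ∀ s, D (s + 1) 0 ≤ 2 * L ^ 2 * X s q + 2 * N s q)
    (hD : ∀ s < S, ∀ t < q, D s (t + 1) ≤ L ^ 2 * X s t)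
    (hX : ∀ s t, X s t ≤ 3 * α ^ 2 * V s t + 3 * C s t + 3 * C s (t + 1))
    (hN0 : ∀ s, N s 0 = 0) (hN : ∀ s < S, ∀ t < q, N s (t + 1) ≤ N s t + L ^ 2 / b * X s t)
    (hM0 : ∀ s, M s 0 = 0) (hM : ∀ s < S, ∀ t < q, M s (t + 1) ≤ M s t + L ^ 2 / (ν * b) * X s t)
    (hdesc : ∀ s t, Φ s (t + 1) ≤ Φ s t - α / 2 * G s t - α / 2 * (1 - L * α) * V s t
      + α * M s t + α * L ^ 2 * C s t) :
    2 * ∑ s ∈ Finset.range S, ∑ t ∈ Finset.range (q + 1), G s t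
      + 3 * (L ^ 2 * ∑ s ∈ Finset.range S, ∑ t ∈ Finset.range (q + 1), C s t)
      ≤ 4 * ((Φ 0 0 - Φmin) / α) + Z / (α * L) := by
  have hb0 : 0 < b := by linarith
  have hC₀ := sum_loops_le_sum_loops_succ q C hCs S hC0 (hCnn _ _)
  have hρ : 0 ≤ 1 - a / 2 := by linarith
  have hCsum := sum_loops_contraction (b := fun s t => 2 * α ^ 2 / a * Y s (t + 1)) hρ hCs hC0
    (hCnn S 0) fun s _ t _ => hC s t
  simp only [← Finset.mul_sum] at hCsum
  -- The very first step has no preceding loop to pay for its jump, so its tracking error is bounded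
  -- directly by `Z`.
  have hYsum := sum_loops_contraction (S := S)
    (b := fun s t => if s = 0 ∧ t = 0 then Z else 2 / a * D s t) hρ hYs hY0
    (hYnn S 0) fun s _ t _ => by
      split_ifs with h
      · obtain ⟨rfl, rfl⟩ := h
        simpa [hY0] using hYZ
      · exact hY s t
  have hDloop : ∀ s < S, ∑ t ∈ Finset.range q, D s (t + 1)
      ≤ L ^ 2 * ∑ t ∈ Finset.range (q + 1), X s t := by
    intro s hs
    rw [Finset.sum_range_succ, mul_add, Finset.mul_sum]
    refine le_add_of_le_of_nonneg (Finset.sum_le_sum fun t ht => hD s hs t ?_)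
      (mul_nonneg (sq_nonneg L) (hXnn s q))
    simpa using ht
  -- The jump at a restart is charged to the displacements of the preceding loop: the last one
  -- through the gradient change, the others through the accumulated estimator error, where `1 ≤ b`
  -- removes the division by `b`.
  have hDstart : ∀ s < S, D (s + 1) 0 ≤ 2 * L ^ 2 * ∑ t ∈ Finset.range (q + 1), X s t := by
    intro s hs
    have h1 := le_sum_of_increments (hN0 s).le (hN s hs) q le_rfl
    rw [← Finset.mul_sum] at h1
    have h2 : L ^ 2 / b * ∑ t ∈ Finset.range q, X s t
        ≤ L ^ 2 * ∑ t ∈ Finset.range q, X s t :=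
      mul_le_mul_of_nonneg_right (div_le_self (sq_nonneg L) hb)
        (Finset.sum_nonneg fun t _ => hXnn s t)
    rw [Finset.sum_range_succ]
    linarith [hD0 s]
  have hRstart : ∀ T ≤ S, ∑ s ∈ Finset.range T, (if s = 0 ∧ (0 : ℕ) = 0 then Z else 2 / a * D s 0)
      ≤ Z + 2 / a * (2 * L ^ 2 * ∑ s ∈ Finset.range T, ∑ t ∈ Finset.range (q + 1), X s t) := by
    intro T hT
    have hnn : 0 ≤ ∑ s ∈ Finset.range T, ∑ t ∈ Finset.range (q + 1), X s t :=
      Finset.sum_nonneg fun s _ => Finset.sum_nonneg fun t _ => hXnn s t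
    rcases T with _ | T
    · simpa using hZ
    rw [Finset.sum_range_succ']
    simp only [Nat.add_eq_zero_iff, one_ne_zero, and_false, false_and, if_false, and_self, if_true]
    rw [add_comm, ← Finset.mul_sum]
    gcongr
    rw [Finset.sum_range_succ, mul_add, Finset.mul_sum]
    refine le_add_of_le_of_nonneg (Finset.sum_le_sum fun s hs => hDstart s ?_) ?_
    · have := Finset.mem_range.1 hs; omega
    · exact mul_nonneg (by positivity) (Finset.sum_nonneg fun t _ => hXnn T t)
  -- The constant 6 is 2 from the increments inside loops plus 4 from the restarts.
  have hRsum : ∑ s ∈ Finset.range S, ∑ t ∈ Finset.range (q + 1),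
      (if s = 0 ∧ t = 0 then Z else 2 / a * D s t)
      ≤ Z + 6 / a * (L ^ 2 * ∑ s ∈ Finset.range S, ∑ t ∈ Finset.range (q + 1), X s t) := by
    simp only [Finset.sum_range_succ' _ q, Finset.sum_add_distrib (f := fun s => ∑ t ∈ _, _)]
    have h1 : ∑ s ∈ Finset.range S, ∑ t ∈ Finset.range q,
        (if s = 0 ∧ t + 1 = 0 then Z else 2 / a * D s (t + 1))
        ≤ 2 / a * (L ^ 2 * ∑ s ∈ Finset.range S, ∑ t ∈ Finset.range (q + 1), X s t) := by
      simp only [Nat.add_eq_zero_iff, one_ne_zero, and_false, if_false, ← Finset.mul_sum]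
      gcongr
      rw [Finset.mul_sum]
      exact Finset.sum_le_sum fun s hs => hDloop s (Finset.mem_range.1 hs)
    have h2 := hRstart S le_rfl
    simp only [Finset.sum_range_succ' _ q, Finset.sum_add_distrib (f := fun s => ∑ t ∈ _, _)]
      at h1 h2
    refine (add_le_add h1 h2).trans (le_of_eq ?_)
    ring
  have hXsum : ∑ s ∈ Finset.range S, ∑ t ∈ Finset.range (q + 1), X s t
      ≤ 3 * α ^ 2 * ∑ s ∈ Finset.range S, ∑ t ∈ Finset.range (q + 1), V s t
        + 3 * ∑ s ∈ Finset.range S, ∑ t ∈ Finset.range (q + 1), C s t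
        + 3 * ∑ s ∈ Finset.range S, ∑ t ∈ Finset.range (q + 1), C s (t + 1) := by
    simp only [Finset.mul_sum, ← Finset.sum_add_distrib]
    exact Finset.sum_le_sum fun s _ => Finset.sum_le_sum fun t _ => hX s t
  have hMsum : ∑ s ∈ Finset.range S, ∑ t ∈ Finset.range (q + 1), M s t
      ≤ q / (ν * b) * (L ^ 2 * ∑ s ∈ Finset.range S, ∑ t ∈ Finset.range (q + 1), X s t) := by
    calc _ ≤ ∑ s ∈ Finset.range S,
          q * ∑ t ∈ Finset.range (q + 1), L ^ 2 / (ν * b) * X s t := by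
          refine Finset.sum_le_sum fun s hs => sum_le_mul_sum_of_increments (hM0 s).le
            (fun t => mul_nonneg (by positivity) (hXnn s t)) (hM s (Finset.mem_range.1 hs))
      _ = _ := by
          simp only [← Finset.mul_sum]
          ring
  have hdsum : Φ S 0 - Φ 0 0
      ≤ -(α / 2) * (∑ s ∈ Finset.range S, ∑ t ∈ Finset.range (q + 1), G s t)
        - α / 2 * (1 - L * α) * (∑ s ∈ Finset.range S, ∑ t ∈ Finset.range (q + 1), V s t)
        + α * (∑ s ∈ Finset.range S, ∑ t ∈ Finset.range (q + 1), M s t)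
        + α * L ^ 2 * ∑ s ∈ Finset.range S, ∑ t ∈ Finset.range (q + 1), C s t := by
    rw [← sum_loops_succ_sub q Φ hΦs S]
    simp only [Finset.mul_sum, ← Finset.sum_add_distrib, ← Finset.sum_sub_distrib]
    refine Finset.sum_le_sum fun s _ => Finset.sum_le_sum fun t _ => ?_
    linarith [hdesc s t]
  have hL2 : 0 ≤ L ^ 2 := sq_nonneg L
  refine combine_estimates (κ := q / (ν * b))
    (c := L ^ 2 * ∑ s ∈ Finset.range S, ∑ t ∈ Finset.range (q + 1), C s (t + 1))
    (y := ∑ s ∈ Finset.range S, ∑ t ∈ Finset.range (q + 1), Y s (t + 1))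
    (x := L ^ 2 * ∑ s ∈ Finset.range S, ∑ t ∈ Finset.range (q + 1), X s t)
    (V := ∑ s ∈ Finset.range S, ∑ t ∈ Finset.range (q + 1), V s t)
    (mul_pos hα hL) ha ha1 (by positivity)
    (Finset.sum_nonneg fun s _ => Finset.sum_nonneg fun t _ => hVnn s t) hZ
    (mul_nonneg hL2 (Finset.sum_nonneg fun s _ => Finset.sum_nonneg fun t _ => hCnn s _))
    hu1 hu2 hu3 (mul_le_mul_of_nonneg_left hC₀ hL2) ?_ ?_ ?_ hMsum ?_
  · have h := mul_le_mul_of_nonneg_left hCsum (show 0 ≤ 2 * a * L ^ 2 by positivity)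
    have e : 2 * a * L ^ 2 * (2 * α ^ 2 / a * ∑ s ∈ Finset.range S,
        ∑ t ∈ Finset.range (q + 1), Y s (t + 1)) = 4 * (α * L) ^ 2 * ∑ s ∈ Finset.range S,
        ∑ t ∈ Finset.range (q + 1), Y s (t + 1) := by field_simp; ring
    rw [e] at h
    linarith
  · have h := mul_le_mul_of_nonneg_left (hYsum.trans hRsum) (show 0 ≤ 2 * a by positivity)
    have e : 2 * a * (Z + 6 / a * (L ^ 2 * ∑ s ∈ Finset.range S,
        ∑ t ∈ Finset.range (q + 1), X s t)) = 2 * a * Z + 12 * (L ^ 2 * ∑ s ∈ Finset.range S,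
        ∑ t ∈ Finset.range (q + 1), X s t) := by field_simp; ring
    rw [e] at h
    linarith
  · have := mul_le_mul_of_nonneg_left hXsum hL2
    have := mul_le_mul_of_nonneg_left hC₀ hL2
    linarith
  · have h : α / 2 * (∑ s ∈ Finset.range S, ∑ t ∈ Finset.range (q + 1), G s t
        + (1 - α * L) * ∑ s ∈ Finset.range S, ∑ t ∈ Finset.range (q + 1), V s t)
        ≤ α / 2 * (2 * ((Φ 0 0 - Φmin) / α)
          + 2 * ∑ s ∈ Finset.range S, ∑ t ∈ Finset.range (q + 1), M s t
          + 2 * (L ^ 2 * ∑ s ∈ Finset.range S, ∑ t ∈ Finset.range (q + 1), C s t)) := by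
      have e : α / 2 * (2 * ((Φ 0 0 - Φmin) / α)) = Φ 0 0 - Φmin := by field_simp
      rw [mul_add (α / 2) _ (2 * (L ^ 2 * _)), mul_add (α / 2) (2 * ((Φ 0 0 - Φmin) / α)), e]
      linarith
    exact le_of_mul_le_mul_left h (by positivity)

end CoupledRecursions

/-! ### Polynomial form of the step-size conditions -/

section StepSize

lemma stepSizeBound_conditions {q B : ℕ} {L α lam : ℝ} (hn : 1 ≤ n) (hq : 1 ≤ q) (hB : 1 ≤ B)
    (hL : 0 < L) (hα : 0 < α) (h : α ≤ stepSizeBound n B q L lam) :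
    lam ^ 2 < 1 ∧ 2688 * (α * L) ^ 2 ≤ (1 - lam ^ 2) ^ 4 ∧
      24 * ((q : ℝ) / (n * B)) * (α * L) ^ 2 ≤ 1 ∧
      1728 * (α * L) ^ 3 * (7 + 24 * ((q : ℝ) / (n * B))) ≤ 4 * (1 - lam ^ 2) ^ 3 := by
  have hn' : (0 : ℝ) < n := by exact_mod_cast hn
  have hq' : (0 : ℝ) < q := by exact_mod_cast hq
  have hB' : (0 : ℝ) < B := by exact_mod_cast hB
  have hu : 0 < α * L := mul_pos hα hL
  unfold stepSizeBound at h
  rw [mul_one_div, le_div_iff₀ (by positivity), le_min_iff, le_min_iff] at h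
  obtain ⟨⟨h1, h2⟩, h3⟩ := h
  have e : α * (2 * L) = 2 * (α * L) := by ring
  rw [e] at h1 h2 h3
  set u := α * L
  have hr : 0 < (4 * n * B : ℝ) / (7 * n * B + 24 * q) := by positivity
  set r := (4 * n * B : ℝ) / (7 * n * B + 24 * q) with hrdef
  have hr3 : (r ^ (1 / 3 : ℝ)) ^ 3 = r := by
    rw [← Real.rpow_natCast, ← Real.rpow_mul hr.le]
    norm_num
  have hrpos : 0 < r ^ (1 / 3 : ℝ) := Real.rpow_pos_of_pos hr _
  -- Were `lam ^ 2` at least 1, the third bound would be nonpositive, contradicting `α > 0`.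
  have hlt : 0 < 1 - lam ^ 2 := by
    by_contra hneg
    push Not at hneg
    have : r ^ (1 / 3 : ℝ) * ((1 - lam ^ 2) / 6) ≤ 0 :=
      mul_nonpos_of_nonneg_of_nonpos hrpos.le (by linarith)
    linarith
  refine ⟨by linarith, ?_, ?_, ?_⟩
  -- Squaring the first bound gives `2688 = 64 * 42`; below, the second is squared and the third
  -- cubed, with `1728 = 2 ^ 3 * 6 ^ 3`.
  · have hs : (0 : ℝ) < Real.sqrt 42 := by positivity
    rw [le_div_iff₀ (by positivity)] at h1
    have := pow_le_pow_left₀ (by positivity) h1 2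
    have hs2 : Real.sqrt 42 ^ 2 = 42 := Real.sq_sqrt (by norm_num)
    calc 2688 * u ^ 2 = 64 * u ^ 2 * Real.sqrt 42 ^ 2 := by rw [hs2]; ring
      _ = (2 * u * (4 * Real.sqrt 42)) ^ 2 := by ring
      _ ≤ _ := this
      _ = _ := by ring
  · have := pow_le_pow_left₀ (by positivity) h2 2
    rw [Real.sq_sqrt (by positivity), le_div_iff₀ (by positivity)] at this
    rw [mul_div_assoc', div_mul_eq_mul_div, div_le_one (by positivity)]
    linarith
  · have := pow_le_pow_left₀ (by positivity) h3 3
    rw [mul_pow (r ^ (1 / 3 : ℝ)), hr3, hrdef, div_mul_eq_mul_div, le_div_iff₀ (by positivity)] at this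
    have e2 : 7 + 24 * ((q : ℝ) / (n * B)) = (7 * n * B + 24 * q) / (n * B) := by
      field_simp
    rw [e2, mul_div_assoc', div_le_iff₀ (by positivity)]
    nlinarith

end StepSize

/-! ### From independent uniform samples to finite averages -/

section Transfer

lemma integral_comp_eq_expect {Ω K : Type*} [MeasurableSpace Ω] {μ : Measure Ω}
    [IsProbabilityMeasure μ] [Fintype K] [DecidableEq K] [NeZero m] {T : K → Ω → Fin m}
    (hmeas : ∀ k, Measurable (T k)) (hunif : ∀ k j, μ (T k ⁻¹' {j}) = (m : ℝ≥0∞)⁻¹)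
    (hind : iIndepFun T μ) (H : (K → Fin m) → ℝ) :
    Integrable (fun ω => H fun k => T k ω) μ ∧ ∫ ω, H (fun k => T k ω) ∂μ = 𝔼 z, H z := by
  have hT : Measurable fun ω k => T k ω := measurable_pi_lambda _ hmeas
  -- Independence and uniformity give every sample path the same mass; on this finite space every
  -- function is integrable.
  have hlaw : ∀ z, μ.map (fun ω k => T k ω) {z} = (m : ℝ≥0∞)⁻¹ ^ Fintype.card K := by
    intro z
    rw [Measure.map_apply hT (measurableSet_singleton z)]
    have e : (fun ω k => T k ω) ⁻¹' {z} = ⋂ k ∈ Finset.univ, T k ⁻¹' {z k} := by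
      ext ω
      simp [funext_iff]
    rw [e, hind.measure_inter_preimage_eq_mul Finset.univ
      fun k _ => measurableSet_singleton (z k)]
    simp [hunif]
  have : IsProbabilityMeasure (μ.map fun ω k => T k ω) :=
    Measure.isProbabilityMeasure_map hT.aemeasurable
  have hint : Integrable H (μ.map fun ω k => T k ω) := Integrable.of_finite
  refine ⟨hint.comp_measurable hT, ?_⟩
  rw [← integral_map hT.aemeasurable hint.aestronglyMeasurable, integral_fintype hint,
    Fintype.expect_eq_sum_div_card, Finset.sum_div]
  refine Finset.sum_congr rfl fun z _ => ?_
  simp [Measure.real, hlaw, div_eq_inv_mul]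

end Transfer

/-! ### The main estimate on the space of sample paths -/

section MainEstimate

variable {f : Fin n → Fin m → Vec p → ℝ} {W : Matrix (Fin n) (Fin n) ℝ} {α L : ℝ} {q B : ℕ}
  {x₀ : Vec p}

lemma loopState_zero_one_y (c : ℕ → ℕ → Fin n → Fin B → Fin m) :
    (loopState f W α q x₀ c 0 1).y = fun i => gradient (localCost f i) x₀ := by
  funext i
  simp [loopState, innerLoop, outerLoop, step, tracker, initState, estimator]

theorem sum_expect_stationarityGap_le [NeZero m] (S : ℕ) (hn : 1 ≤ n) (hB : 1 ≤ B) (hL : 0 < L)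
    (hf : IsMeanSquaredSmooth f L) (hF : BddBelow (Set.range (globalCost f)))
    (hW : W ∈ doublyStochastic ℝ (Fin n)) (hα : 0 < α) (hlam : mixingRate W ^ 2 < 1)
    (hu1 : 2688 * (α * L) ^ 2 ≤ (1 - mixingRate W ^ 2) ^ 4)
    (hu2 : 24 * ((q : ℝ) / (n * B)) * (α * L) ^ 2 ≤ 1)
    (hu3 : 1728 * (α * L) ^ 3 * (7 + 24 * ((q : ℝ) / (n * B))) ≤ 4 * (1 - mixingRate W ^ 2) ^ 3) :
    ∑ s ∈ Finset.range S, ∑ t ∈ Finset.range (q + 1), 𝔼 z : Position S q n B → Fin m,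
      (1 / (n : ℝ)) * ∑ i, stationarityGap f L (loopState f W α q x₀ (samplePath z) s t).x i
      ≤ 4 * ((globalCost f x₀ - ⨅ x, globalCost f x) / α)
        + meanSq (fun i => gradient (localCost f i) x₀) / (α * L) := by
  have hn' : (0 : ℝ) < n := by exact_mod_cast hn
  have ha : 0 < 1 - mixingRate W ^ 2 := by linarith
  have hst := fun (z : Position S q n B → Fin m) s t =>
    average_y_eq_average_vPrev (f := f) (α := α) (q := q) (x₀ := x₀) (samplePath z) hW s t
  have hdev₀ : ∀ v : Vec p, meanSq (deviation fun _ : Fin n => v) = 0 := fun v => by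
    rw [deviation_const hn]; simp [meanSq]
  have h := sum_loops_le (S := S) (q := q) (α := α) (L := L) (a := 1 - mixingRate W ^ 2)
    (ν := n) (b := B) (Z := meanSq fun i => gradient (localCost f i) x₀)
    (Φmin := ⨅ x, globalCost f x)
    (C := fun s t => 𝔼 z : Position S q n B → Fin m,
      meanSq (deviation (loopState f W α q x₀ (samplePath z) s t).x))
    (Y := fun s t => 𝔼 z : Position S q n B → Fin m,
      meanSq (deviation (loopState f W α q x₀ (samplePath z) s t).y))
    (D := fun s t => 𝔼 z : Position S q n B → Fin m,
      meanSq (loopEst f W α q x₀ (samplePath z) s t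
        - (loopState f W α q x₀ (samplePath z) s t).vPrev))
    (X := fun s t => 𝔼 z : Position S q n B → Fin m,
      meanSq ((loopState f W α q x₀ (samplePath z) s (t + 1)).x
        - (loopState f W α q x₀ (samplePath z) s t).x))
    (N := fun s t => 𝔼 z : Position S q n B → Fin m,
      meanSq (loopErr f W α q x₀ (samplePath z) s t))
    (M := fun s t => 𝔼 z : Position S q n B → Fin m,
      ‖average (loopErr f W α q x₀ (samplePath z) s t)‖ ^ 2)
    (V := fun s t => 𝔼 z : Position S q n B → Fin m,
      ‖average (loopEst f W α q x₀ (samplePath z) s t)‖ ^ 2)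
    (G := fun s t => 𝔼 z : Position S q n B → Fin m,
      ‖gradient (globalCost f) (average (loopState f W α q x₀ (samplePath z) s t).x)‖ ^ 2)
    (Φ := fun s t => 𝔼 z : Position S q n B → Fin m,
      globalCost f (average (loopState f W α q x₀ (samplePath z) s t).x))
    hα hL ha (by linarith [sq_nonneg (mixingRate W)]) hn' (by exact_mod_cast hB)
    (meanSq_nonneg _) hu1 hu2 hu3
    (Finset.expect_eq_zero fun z _ => hdev₀ x₀) (fun _ => rfl)
    (fun _ _ => Finset.expect_nonneg fun _ _ => meanSq_nonneg _)
    (Finset.expect_eq_zero fun z _ => hdev₀ 0) (fun _ => rfl)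
    (fun _ _ => Finset.expect_nonneg fun _ _ => meanSq_nonneg _)
    (fun _ _ => Finset.expect_nonneg fun _ _ => meanSq_nonneg _)
    (fun _ _ => Finset.expect_nonneg fun _ _ => sq_nonneg _)
    (fun _ => rfl) ?_ ?_ ?_ ?_ ?_
    (fun s hs t ht => expect_meanSq_loopEst_sub_le hf hB hs ht) ?_
    (fun s => Finset.expect_eq_zero fun z _ => by rw [loopErr_zero]; simp [meanSq])
    (fun s hs t ht => expect_meanSq_loopErr_succ_le hf hB hs ht)
    (fun s => Finset.expect_eq_zero fun z _ => by rw [loopErr_zero]; simp [average])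
    (fun s hs t ht => expect_norm_sq_average_loopErr_succ_le hf hn hB hs ht) ?_
  · have e : globalCost f (average (initState n x₀).x) = globalCost f x₀ :=
      congrArg _ (average_const hn x₀)
    have e' : 𝔼 z : Position S q n B → Fin m,
        globalCost f (average (loopState f W α q x₀ (samplePath z) 0 0).x) = globalCost f x₀ :=
      (Fintype.expect_const _).trans e
    rw [e'] at h
    refine le_trans ?_ h
    rw [← mul_assoc]
    simp only [Finset.mul_sum, ← Finset.sum_add_distrib]
    refine Finset.sum_le_sum fun s _ => Finset.sum_le_sum fun t _ => ?_
    rw [Finset.mul_expect, Finset.mul_expect, ← Finset.expect_add_distrib]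
    refine Finset.expect_le_expect fun z _ => ?_
    rw [← Finset.mul_sum]
    exact mean_stationarityGap_le hn hL.le hf _
  · exact Finset.le_expect Finset.univ_nonempty fun z _ => ciInf_le hF _
  · intro s t
    rw [Finset.mul_expect, Finset.mul_expect, ← Finset.expect_add_distrib]
    refine Finset.expect_le_expect fun z _ => (meanSq_deviation_step_x_le
      (st := loopState f W α q x₀ (samplePath z) s t) hW hlam).trans (le_of_eq ?_)
    rw [loopState_succ]
    ring
  · intro s t
    rw [Finset.mul_expect, Finset.mul_expect, ← Finset.expect_add_distrib]
    refine Finset.expect_le_expect fun z _ => (meanSq_deviation_step_y_le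
      (st := loopState f W α q x₀ (samplePath z) s t) hW hlam).trans (le_of_eq ?_)
    rw [loopEst]
    ring
  · refine Finset.expect_le Finset.univ_nonempty fun z _ => ?_
    rw [loopState_zero_one_y]
    exact meanSq_deviation_le _
  · intro s
    rw [Finset.mul_expect, Finset.mul_expect, ← Finset.expect_add_distrib]
    exact Finset.expect_le_expect fun z _ => meanSq_loopEst_sub_vPrev_le _ hf s
  · intro s t
    rw [Finset.mul_expect, Finset.mul_expect, Finset.mul_expect, ← Finset.expect_add_distrib,
      ← Finset.expect_add_distrib]
    exact Finset.expect_le_expect fun z _ => meanSq_step_x_sub_le hW (hst z s t) hn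
  · intro s t
    rw [Finset.mul_expect, Finset.mul_expect, Finset.mul_expect, Finset.mul_expect,
      ← Finset.expect_sub_distrib, ← Finset.expect_sub_distrib, ← Finset.expect_add_distrib,
      ← Finset.expect_add_distrib]
    refine Finset.expect_le_expect fun z _ => ?_
    rw [average_loopErr]
    exact globalCost_step_le hn hL.le hα.le hf hW (hst z s t)

end MainEstimate

end GTSarah

end

/-! ### The complexity bound on the given probability space -/

theorem theorem3p4 {Ω : Type*} [MeasurableSpace Ω] (μ : Measure Ω) [IsProbabilityMeasure μ]
    (n m p q B : ℕ) (hn : 1 ≤ n) (hq : 1 ≤ q) (hB : 1 ≤ B) (hBm : B ≤ m)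
    (f : Fin n → Fin m → GTSarah.Vec p → ℝ) (L : ℝ) (hL : 0 < L)
    (hf : GTSarah.IsMeanSquaredSmooth f L)
    (hF : BddBelow (Set.range (GTSarah.globalCost f)))
    (W : Matrix (Fin n) (Fin n) ℝ) (hW : GTSarah.IsWeightMatrix W)
    (τ : ℕ → ℕ → Fin n → Fin B → Ω → Fin m) (hτ : GTSarah.IsUniformSampling μ q τ)
    (x₀ : GTSarah.Vec p) (α : ℝ) (hα : 0 < α)
    (hα' : α ≤ GTSarah.stepSizeBound n B q L (GTSarah.mixingRate W))
    (ε : ℝ) (hε : 0 < ε) (S : ℕ) (hS : 1 ≤ S)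
    (hS' : GTSarah.outerLoopBound f L α ε q x₀ ≤ S) :
    GTSarah.FindsStationaryPoint μ f L q
      (fun s t i ω => GTSarah.iterate f W α q (fun s t i l => τ s t i l ω) x₀ s t i) ε S := by
  have : NeZero m := ⟨by omega⟩
  let T : GTSarah.Position S q n B → Ω → Fin m := fun k => τ k.1 k.2.1 k.2.2.1 k.2.2.2
  have hT := fun H => GTSarah.integral_comp_eq_expect (μ := μ) (T := T)
    (fun k => hτ.measurable _ _ k.2.1.2 _ _) (fun k j => hτ.uniform _ _ k.2.1.2 _ _ j)
    (hτ.indep.precomp (g := fun k : GTSarah.Position S q n B => ((k.1 : ℕ), k.2))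
      fun k k' h => by
        simp only [Prod.mk.injEq] at h
        exact Prod.ext (Fin.ext h.1) h.2) H
  -- By adaptedness the actual iterates of the first `S` loops depend only on the finite family `T`.
  have hpath : ∀ s < S, ∀ t ≤ q, ∀ ω,
      (fun i => GTSarah.iterate f W α q (fun s t i l => τ s t i l ω) x₀ s t i)
        = (GTSarah.loopState f W α q x₀ (GTSarah.samplePath fun k => T k ω) s t).x := by
    intro s hs t ht ω
    have h : GTSarah.loopState f W α q x₀ (fun s t i l => τ s t i l ω) s t
        = GTSarah.loopState f W α q x₀ (GTSarah.samplePath fun k => T k ω) s t := by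
      refine GTSarah.loopState_congr (by omega) (fun s' hs' u hu => ?_) (fun u hu _ => ?_)
      · funext i l
        rw [GTSarah.samplePath_apply _ (hs'.trans hs) hu]
      · funext i l
        rw [GTSarah.samplePath_apply _ hs hu]
    exact congrArg GTSarah.State.x h
  have hgap : ∀ s < S, ∀ t ≤ q, ∀ i,
      (fun ω => GTSarah.stationarityGap f L (fun r => GTSarah.iterate f W α q
        (fun s t i l => τ s t i l ω) x₀ s t r) i)
      = fun ω => GTSarah.stationarityGap f L
        (GTSarah.loopState f W α q x₀ (GTSarah.samplePath fun k => T k ω) s t).x i :=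
    fun s hs t ht i => funext fun ω => by rw [hpath s hs t ht ω]
  obtain ⟨hlam, hu1, hu2, hu3⟩ :=
    GTSarah.stepSizeBound_conditions hn hq hB hL hα hα'
  refine ⟨fun s hs t ht i => ?_, ?_⟩
  · rw [hgap s hs t ht i]
    exact (hT fun z => GTSarah.stationarityGap f L
      (GTSarah.loopState f W α q x₀ (GTSarah.samplePath z) s t).x i).1
  have hmain := GTSarah.sum_expect_stationarityGap_le (x₀ := x₀) S hn hB hL hf hF hW.1 hα hlam
    hu1 hu2 hu3
  have hsum : ∑ s ∈ Finset.range S, ∑ t ∈ Finset.range (q + 1),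
      (1 / (n : ℝ)) * ∑ i, ∫ ω, GTSarah.stationarityGap f L (fun r => GTSarah.iterate f W α q
        (fun s t i l => τ s t i l ω) x₀ s t r) i ∂μ
      = ∑ s ∈ Finset.range S, ∑ t ∈ Finset.range (q + 1),
        𝔼 z : GTSarah.Position S q n B → Fin m, (1 / (n : ℝ)) * ∑ i, GTSarah.stationarityGap f L
          (GTSarah.loopState f W α q x₀ (GTSarah.samplePath z) s t).x i := by
    refine Finset.sum_congr rfl fun s hs => Finset.sum_congr rfl fun t ht => ?_
    rw [← Finset.mul_expect, Finset.expect_sum_comm]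
    congr 1
    refine Finset.sum_congr rfl fun i _ => ?_
    rw [hgap s (Finset.mem_range.1 hs) t (Nat.lt_succ_iff.1 (Finset.mem_range.1 ht)) i]
    exact (hT fun z => GTSarah.stationarityGap f L
      (GTSarah.loopState f W α q x₀ (GTSarah.samplePath z) s t).x i).2
  have hS0 : (0 : ℝ) < S := by exact_mod_cast hS
  rw [hsum, one_div, inv_mul_le_iff₀ (by positivity)]
  refine hmain.trans ?_
  rw [GTSarah.outerLoopBound, div_mul_eq_mul_div, one_mul, div_le_iff₀ (by positivity)] at hS'
  have e : 4 * ((GTSarah.globalCost f x₀ - ⨅ x, GTSarah.globalCost f x) / α)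
      + GTSarah.meanSq (fun i => gradient (GTSarah.localCost f i) x₀) / (α * L)
      = (4 * L * (GTSarah.globalCost f x₀ - ⨅ x, GTSarah.globalCost f x)
        + (1 / (n : ℝ)) * ∑ i, ‖gradient (GTSarah.localCost f i) x₀‖ ^ 2) / (α * L) := by
    rw [GTSarah.meanSq]
    field_simp
  rw [e, div_le_iff₀ (by positivity)]
  linarith
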